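/- Let $q\in[1,\infty]$ and let $V\in L^q[0,1]$ be real-valued. Let $\mathscr T_V=-\Delta+V$ be the Schr\"odinger operator in $L^2[0,1]$ with Dirichlet boundary conditions, that is, $\mathscr T_V u=-u''+Vu$ on the domain of all $u\in L^2[0,1]$ such that $u$ and $u'$ are absolutely continuous on $[0,1]$, $u(0)=u(1)=0$ and $-u''+Vu\in L^2[0,1]$. Then every eigenvalue of $\mathscr T_V$ has finite multiplicity, and the spectral zeta series $$\zeta_{\mathscr T_V}(s)=\sum_{\lambda\neq 0} m(\lambda)\,\lambda^{-s},$$ where $\lambda$ runs over the nonzero eigenvalues of $\mathscr T_V$, $m(\lambda)$ is the multiplicity of $\lambda$ and $\lambda^{-s}$ is the principal power, converges absolutely for $\operatorname{Re}(s)>1/2$. (If $V\ge 0$ almost everywhere, all eigenvalues are positive and this is the usual sum $\sum_n\lambda_n^{-s}$ over all eigenvalues counted with multiplicity.) Moreover $\zeta_{\mathscr T_V}$ extends from $\operatorname{Re}(s)>1/2$ to a meromorphic function on the half-plane $\operatorname{Re}(s)>-1/2$ which is analytic on this half-plane except for a simple pole at $s=1/2$ with residue $1/(2\pi)$; in particular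 the extension is analytic at $s=0$. -/

import Mathlib

open MeasureTheory Set Filter Topology
open scoped ENNReal

noncomputable section

namespace DirichletSchrodinger

/-- Lebesgue measure on the unit interval `[0,1]`. -/
abbrev unitMeasure : Measure ℝ := volume.restrict (Icc (0 : ℝ) 1)

/-- The complex Hilbert space `L²[0,1]`. -/
abbrev L2 : Type := Lp ℂ 2 unitMeasure

/-- `u` is continuously differentiable on `[0,1]` with absolutely continuous derivative `v = u'`,
satisfies the Dirichlet conditions `u 0 = u 1 = 0`, and `-u'' + V u = g` almost everywhere
on `[0,1]` (written as `v' = V u - g`). -/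
structure SolvesDirichlet (V : ℝ → ℝ) (u v g : ℝ → ℂ) : Prop where
  hasDeriv : ∀ x ∈ Icc (0 : ℝ) 1, HasDerivWithinAt u (v x) (Icc 0 1) x
  absCont : AbsolutelyContinuousOnInterval v 0 1
  left : u 0 = 0
  right : u 1 = 0
  eqn : ∀ᵐ x ∂unitMeasure, HasDerivAt v ((V x : ℂ) * u x - g x) x

/-- The graph of `-Δ + V` with Dirichlet boundary conditions in `L²[0,1]`: the pairs `(f, g)`
of elements of `L²` such that `f` has a representative `u` with `u` and `u'` absolutely continuous,
`u 0 = u 1 = 0` and `-u'' + V u = g` almost everywhere. -/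
def schrodingerGraph (V : ℝ → ℝ) : Submodule ℂ (L2 × L2) where
  carrier := {p | ∃ u v : ℝ → ℂ, (p.1 : ℝ → ℂ) =ᵐ[unitMeasure] u ∧ SolvesDirichlet V u v p.2}
  zero_mem' := by
    refine ⟨fun _ => 0, fun _ => 0, Lp.coeFn_zero _ _ _, ?_⟩
    refine ⟨fun x _ => hasDerivWithinAt_const _ _ _, ?_, rfl, rfl, ?_⟩
    · exact ((LipschitzWith.const (0 : ℂ)).lipschitzOnWith).absolutelyContinuousOnInterval
    · filter_upwards [Lp.coeFn_zero ℂ 2 unitMeasure] with x hx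
      have : ((0 : L2 × L2).2 : ℝ → ℂ) x = 0 := hx
      rw [this]
      simpa using hasDerivAt_const x (0 : ℂ)
  add_mem' := by
    rintro p q ⟨u, v, hu, h⟩ ⟨u', v', hu', h'⟩
    refine ⟨u + u', v + v', (Lp.coeFn_add p.1 q.1).trans (hu.add hu'), ?_⟩
    refine ⟨fun x hx => (h.hasDeriv x hx).add (h'.hasDeriv x hx), h.absCont.add h'.absCont,
      by simp [h.left, h'.left], by simp [h.right, h'.right], ?_⟩
    filter_upwards [Lp.coeFn_add p.2 q.2, h.eqn, h'.eqn] with x hx h1 h2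
    have hx' : ((p + q).2 : ℝ → ℂ) x = (p.2 : ℝ → ℂ) x + (q.2 : ℝ → ℂ) x := hx
    rw [hx']
    refine (h1.add h2).congr_deriv ?_
    simp only [Pi.add_apply]
    ring
  smul_mem' := by
    rintro c p ⟨u, v, hu, h⟩
    refine ⟨c • u, c • v, (Lp.coeFn_smul c p.1).trans (hu.const_smul c), ?_⟩
    refine ⟨fun x hx => (h.hasDeriv x hx).const_smul c, h.absCont.const_smul c,
      by simp [h.left], by simp [h.right], ?_⟩
    filter_upwards [Lp.coeFn_smul c p.2, h.eqn] with x hx h1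
    have hx' : ((c • p).2 : ℝ → ℂ) x = c * (p.2 : ℝ → ℂ) x := hx
    rw [hx']
    refine (h1.const_smul c).congr_deriv ?_
    simp only [Pi.smul_apply, smul_eq_mul]
    ring

/-- The graph is single-valued, so that it is the graph of an operator. -/
theorem schrodingerGraph_singleValued (V : ℝ → ℝ) :
    ∀ p ∈ schrodingerGraph V, p.1 = 0 → p.2 = 0 := by
  rintro ⟨f, g⟩ ⟨u, v, hu, h⟩ hf
  have hf' : f = 0 := hf
  subst hf'
  have hu0 : u =ᵐ[unitMeasure] fun _ => (0 : ℂ) := hu.symm.trans (Lp.coeFn_zero _ _ _)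
  have hue : EqOn u (fun _ => 0) (Icc 0 1) :=
    Measure.eqOn_Icc_of_ae_eq volume zero_ne_one hu0
      (fun x hx => (h.hasDeriv x hx).continuousWithinAt) continuousOn_const
  have hv : ∀ x ∈ Icc (0 : ℝ) 1, v x = 0 := fun x hx =>
    (uniqueDiffOn_Icc zero_lt_one x hx).eq_deriv _ (h.hasDeriv x hx)
      ((hasDerivWithinAt_const x (Icc (0 : ℝ) 1) (0 : ℂ)).congr hue (hue hx))
  have hIoo : ∀ᵐ x ∂unitMeasure, x ∈ Ioo (0 : ℝ) 1 := by
    rw [unitMeasure, ← restrict_Ioo_eq_restrict_Icc]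
    exact ae_restrict_mem measurableSet_Ioo
  refine (Lp.eq_zero_iff_ae_eq_zero).2 ?_
  filter_upwards [h.eqn, hIoo] with x hx hxI
  have h0 : HasDerivAt v 0 x :=
    (hasDerivAt_const x (0 : ℂ)).congr_of_eventuallyEq <| by
      filter_upwards [Ioo_mem_nhds hxI.1 hxI.2] with y hy using hv y (Ioo_subset_Icc_self hy)
  have h1 := hx.unique h0
  rw [hue (Ioo_subset_Icc_self hxI)] at h1
  simpa using h1

/-- The operator `-Δ + V` in `L²[0,1]` with Dirichlet boundary conditions, on its maximal
domain. -/
def schrodingerOp (V : ℝ → ℝ) : L2 →ₗ.[ℂ] L2 := (schrodingerGraph V).toLinearPMap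

theorem schrodingerOp_graph (V : ℝ → ℝ) : (schrodingerOp V).graph = schrodingerGraph V :=
  Submodule.toLinearPMap_graph_eq _ (schrodingerGraph_singleValued V)

/-- The eigenspace of an unbounded operator: the `f` in its domain with `T f = z f`. -/
def eigenspace {H : Type*} [AddCommGroup H] [Module ℂ H] (T : H →ₗ.[ℂ] H) (z : ℂ) :
    Submodule ℂ H :=
  T.graph.comap (LinearMap.prod LinearMap.id (z • LinearMap.id))

theorem mem_eigenspace {H : Type*} [AddCommGroup H] [Module ℂ H] (T : H →ₗ.[ℂ] H) (z : ℂ)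
    (f : H) : f ∈ eigenspace T z ↔ ∃ h : f ∈ T.domain, T ⟨f, h⟩ = z • f := by
  simp [eigenspace, LinearPMap.mem_graph_iff]

/-- The set of nonzero eigenvalues of `T`. -/
def nonzeroEigenvalues {H : Type*} [AddCommGroup H] [Module ℂ H] (T : H →ₗ.[ℂ] H) : Set ℂ :=
  {z | eigenspace T z ≠ ⊥ ∧ z ≠ 0}

/-- The term `m(z) z⁻ˢ` of the spectral zeta series, where `m(z)` is the multiplicity of the
eigenvalue `z` and the power is the principal one. -/
def zetaTerm {H : Type*} [AddCommGroup H] [Module ℂ H] (T : H →ₗ.[ℂ] H) (s : ℂ)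
    (z : nonzeroEigenvalues T) : ℂ :=
  (Module.finrank ℂ (eigenspace T (z : ℂ)) : ℂ) * (z : ℂ) ^ (-s)

/-- The spectral zeta series of `T`: the sum of `z⁻ˢ` over the nonzero eigenvalues of `T`,
counted with multiplicity. -/
def spectralZeta {H : Type*} [AddCommGroup H] [Module ℂ H] (T : H →ₗ.[ℂ] H) (s : ℂ) : ℂ :=
  ∑' z : nonzeroEigenvalues T, zetaTerm T s z

/-- `F` has a simple pole at `z₀` with residue `r`. -/
def HasSimplePole (F : ℂ → ℂ) (z₀ r : ℂ) : Prop :=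
  meromorphicOrderAt F z₀ = -1 ∧ Tendsto (fun s => (s - z₀) * F s) (𝓝[≠] z₀) (𝓝 r)

end DirichletSchrodinger

end

/-! The claim is a comparison with the free operator, whose eigenvalues `(π m)²` give `freeZeta s =
π^(-2s) ζ(2s)`, with a single pole at `1/2`. Suppose that all but finitely many eigenvalues are
simple and equal to `κ n ^ 2` with `κ n = π m + O(1/m)`, `m = n + N`. By the mean value inequality
the powers `κ n ^ (-2s)` and `(π m) ^ (-2s)` differ by `O(m ^ (-2 Re s - 2))`, locally uniformly in
`s`, so the differences sum to a holomorphic function on `Re s > -1/2`. The finitely many other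
eigenvalues and free terms contribute entire functions (`zeta_continuation`).

The asymptotics come from a modified Prüfer phase, which needs only `V ∈ L¹`. With `u = (r/k) sin
θ`, `u' = r cos θ`, `θ = k x + η`, the initial value problem `u'' = (V - k²) u`, `u 0 = 0` turns
into `η' = -k⁻¹ V sin² θ`, `η 0 = 0`. For large `k` a contraction solves it, and `|η| ≤ ‖V‖₁ / k`.
Then `k²` is an eigenvalue iff `k + η 1 ∈ π ℤ` (`eigenspace_ne_bot_iff`). Since `η 1` is Lipschitz
in `k` with constant `1/2` (`IsPhase.lipschitz`), `k + η 1` is continuous and injective in `k` and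
meets each large multiple of `π` exactly once.

No spectral theorem is needed. Eigenvalues are real by symmetry, simple by Cauchy uniqueness, and
finite in number below any level (`finite_eigenvalue_le`), because the energy bounds the sup norm by
the `L²` norm on spans of eigenfunctions. -/

namespace AbsolutelyContinuousOnInterval

/-! ### Calculus of absolutely continuous functions -/

variable {X Y : Type*} [PseudoMetricSpace X] [PseudoMetricSpace Y] {a b : ℝ}

/-- A distance-decreasing map preserves absolute continuity. -/
theorem comp_of_dist_le {f : ℝ → X} (hf : AbsolutelyContinuousOnInterval f a b) (φ : X → Y)
    (hφ : ∀ x y, dist (φ x) (φ y) ≤ dist x y) :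
    AbsolutelyContinuousOnInterval (fun x => φ (f x)) a b := by
  unfold AbsolutelyContinuousOnInterval at hf ⊢
  exact squeeze_zero (fun E => Finset.sum_nonneg fun _ _ => dist_nonneg)
    (fun E => Finset.sum_le_sum fun _ _ => hφ _ _) hf

theorem re {f : ℝ → ℂ} (hf : AbsolutelyContinuousOnInterval f a b) :
    AbsolutelyContinuousOnInterval (fun x => (f x).re) a b :=
  hf.comp_of_dist_le Complex.re fun x y => by
    rw [Real.dist_eq, dist_eq_norm, ← Complex.sub_re]; exact Complex.abs_re_le_norm _

theorem im {f : ℝ → ℂ} (hf : AbsolutelyContinuousOnInterval f a b) :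
    AbsolutelyContinuousOnInterval (fun x => (f x).im) a b :=
  hf.comp_of_dist_le Complex.im fun x y => by
    rw [Real.dist_eq, dist_eq_norm, ← Complex.sub_im]; exact Complex.abs_im_le_norm _

theorem star {f : ℝ → ℂ} (hf : AbsolutelyContinuousOnInterval f a b) :
    AbsolutelyContinuousOnInterval (fun x => starRingEnd ℂ (f x)) a b :=
  hf.comp_of_dist_le (starRingEnd ℂ) fun x y => by
    rw [Complex.dist_conj_conj]

theorem ofReal {f : ℝ → ℝ} (hf : AbsolutelyContinuousOnInterval f a b) :
    AbsolutelyContinuousOnInterval (fun x => (f x : ℂ)) a b :=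
  hf.comp_of_dist_le (fun x : ℝ => (x : ℂ)) fun x y => by
    rw [Complex.isometry_ofReal.dist_eq]

theorem deriv_ae_eq_of_hasDerivAt {f g : ℝ → ℝ} (hab : a ≤ b)
    (h : ∀ᵐ x ∂volume.restrict (Icc a b), HasDerivAt f (g x) x) :
    deriv f =ᵐ[volume.restrict (uIoc a b)] g := by
  rw [uIoc_of_le hab, restrict_Ioc_eq_restrict_Icc]
  filter_upwards [h] with x hx using hx.deriv

theorem intervalIntegrable_of_hasDerivAt {f g : ℝ → ℝ} (hab : a ≤ b)
    (hf : AbsolutelyContinuousOnInterval f a b)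
    (h : ∀ᵐ x ∂volume.restrict (Icc a b), HasDerivAt f (g x) x) :
    IntervalIntegrable g volume a b :=
  hf.intervalIntegrable_deriv.congr_ae (deriv_ae_eq_of_hasDerivAt hab h)

theorem integral_eq_sub {f g : ℝ → ℝ} (hab : a ≤ b)
    (hf : AbsolutelyContinuousOnInterval f a b)
    (h : ∀ᵐ x ∂volume.restrict (Icc a b), HasDerivAt f (g x) x) :
    ∫ x in a..b, g x = f b - f a := by
  rw [← hf.integral_deriv_eq_sub]
  exact intervalIntegral.integral_congr_ae_restrict (deriv_ae_eq_of_hasDerivAt hab h).symm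

theorem intervalIntegrable_of_hasDerivAt_complex {f g : ℝ → ℂ} (hab : a ≤ b)
    (hf : AbsolutelyContinuousOnInterval f a b)
    (h : ∀ᵐ x ∂volume.restrict (Icc a b), HasDerivAt f (g x) x) :
    IntervalIntegrable g volume a b := by
  have h1 : IntervalIntegrable (fun x => (g x).re) volume a b :=
    intervalIntegrable_of_hasDerivAt hab hf.re <| by
      filter_upwards [h] with x hx using (Complex.reCLM.hasFDerivAt.comp_hasDerivAt x hx)
  have h2 : IntervalIntegrable (fun x => (g x).im) volume a b :=
    intervalIntegrable_of_hasDerivAt hab hf.im <| by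
      filter_upwards [h] with x hx using (Complex.imCLM.hasFDerivAt.comp_hasDerivAt x hx)
  have h3 : IntervalIntegrable (fun x => ((g x).re : ℂ) + ((g x).im : ℂ) * Complex.I) volume a b :=
    IntervalIntegrable.add ⟨h1.1.ofReal, h1.2.ofReal⟩
      (IntervalIntegrable.mul_const ⟨h2.1.ofReal, h2.2.ofReal⟩ Complex.I)
  simpa only [Complex.re_add_im] using h3

/-- The fundamental theorem of calculus for complex absolutely continuous functions. -/
theorem integral_eq_sub_complex {f g : ℝ → ℂ} (hab : a ≤ b)
    (hf : AbsolutelyContinuousOnInterval f a b)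
    (h : ∀ᵐ x ∂volume.restrict (Icc a b), HasDerivAt f (g x) x) :
    ∫ x in a..b, g x = f b - f a := by
  have hg := intervalIntegrable_of_hasDerivAt_complex hab hf h
  have h1 := integral_eq_sub (g := fun x => (g x).re) hab hf.re <| by
      filter_upwards [h] with x hx using (Complex.reCLM.hasFDerivAt.comp_hasDerivAt x hx)
  have h2 := integral_eq_sub (g := fun x => (g x).im) hab hf.im <| by
      filter_upwards [h] with x hx using (Complex.imCLM.hasFDerivAt.comp_hasDerivAt x hx)
  apply Complex.ext
  · rw [Complex.sub_re, ← h1]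
    exact (Complex.reCLM.intervalIntegral_comp_comm hg).symm
  · rw [Complex.sub_im, ← h2]
    exact (Complex.imCLM.intervalIntegral_comp_comm hg).symm

/-- The restriction of `integral_eq_sub_complex` to an initial segment. -/
theorem integral_eq_sub_complex_of_mem {f g : ℝ → ℂ} {x : ℝ} (hx : x ∈ Icc a b)
    (hf : AbsolutelyContinuousOnInterval f a b)
    (h : ∀ᵐ x ∂volume.restrict (Icc a b), HasDerivAt f (g x) x) :
    ∫ t in a..x, g t = f x - f a := by
  refine integral_eq_sub_complex hx.1 (hf.mono ?_) ?_
  · rw [uIcc_of_le hx.1, uIcc_of_le (hx.1.trans hx.2)]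
    exact Icc_subset_Icc_right hx.2
  · exact ae_restrict_of_ae_restrict_of_subset (Icc_subset_Icc_right hx.2) h

theorem of_hasDerivWithinAt {f g : ℝ → ℂ} (hab : a ≤ b)
    (h : ∀ x ∈ Icc a b, HasDerivWithinAt f (g x) (Icc a b) x) (hg : ContinuousOn g (Icc a b)) :
    AbsolutelyContinuousOnInterval f a b := by
  obtain ⟨C, hC⟩ := isCompact_Icc.exists_bound_of_continuousOn hg
  have : LipschitzOnWith C.toNNReal f (uIcc a b) := by
    rw [uIcc_of_le hab]
    refine Convex.lipschitzOnWith_of_nnnorm_hasDerivWithin_le (convex_Icc a b) h fun x hx => ?_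
    rw [← NNReal.coe_le_coe, coe_nnnorm]
    exact (hC x hx).trans (Real.le_coe_toNNReal C)
  exact this.absolutelyContinuousOnInterval

end AbsolutelyContinuousOnInterval

namespace DirichletSchrodinger

/-! ### Cauchy uniqueness and simplicity of the eigenvalues -/

theorem ae_mem_Ioo : ∀ᵐ x ∂unitMeasure, x ∈ Ioo (0 : ℝ) 1 := by
  rw [unitMeasure, ← restrict_Ioo_eq_restrict_Icc]
  exact ae_restrict_mem measurableSet_Ioo

theorem ae_hasDerivAt_of_hasDerivWithinAt {u v : ℝ → ℂ}
    (h : ∀ x ∈ Icc (0 : ℝ) 1, HasDerivWithinAt u (v x) (Icc 0 1) x) :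
    ∀ᵐ x ∂unitMeasure, HasDerivAt u (v x) x := by
  filter_upwards [ae_mem_Ioo] with x hx
  exact (h x (Ioo_subset_Icc_self hx)).hasDerivAt (Icc_mem_nhds hx.1 hx.2)

theorem intervalIntegrable_of_integrable_unit {E : Type*} [NormedAddCommGroup E] {f : ℝ → E}
    (h : Integrable f unitMeasure) : IntervalIntegrable f volume 0 1 :=
  (intervalIntegrable_iff_integrableOn_Icc_of_le zero_le_one).2 h

theorem integral_unit_eq {E : Type*} [NormedAddCommGroup E] [NormedSpace ℝ E] (f : ℝ → E) :
    ∫ x, f x ∂unitMeasure = ∫ x in (0 : ℝ)..1, f x := by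
  rw [intervalIntegral.integral_of_le zero_le_one, integral_Icc_eq_integral_Ioc]

theorem intervalIntegral_le_integral_unit {f : ℝ → ℝ} (hf : Integrable f unitMeasure)
    (h0 : ∀ x, 0 ≤ f x) {x : ℝ} (hx : x ∈ Icc (0 : ℝ) 1) :
    ∫ t in (0 : ℝ)..x, f t ≤ ∫ t, f t ∂unitMeasure := by
  rw [integral_unit_eq]
  exact intervalIntegral.integral_mono_interval le_rfl hx.1 hx.2
    (Eventually.of_forall h0) (intervalIntegrable_of_integrable_unit hf)

/-- A solution of `u'' = q u` with vanishing Cauchy data at `0` vanishes. -/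
theorem eq_zero_of_cauchy_data_eq_zero {q u v : ℝ → ℂ} (hq : Integrable q unitMeasure)
    (hu : ∀ x ∈ Icc (0 : ℝ) 1, HasDerivWithinAt u (v x) (Icc 0 1) x)
    (hv : AbsolutelyContinuousOnInterval v 0 1)
    (heq : ∀ᵐ x ∂unitMeasure, HasDerivAt v (q x * u x) x) (hu0 : u 0 = 0) (hv0 : v 0 = 0) :
    ∀ x ∈ Icc (0 : ℝ) 1, u x = 0 := by
  have hvc : ContinuousOn v (Icc 0 1) := by
    simpa [uIcc_of_le zero_le_one] using hv.continuousOn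
  have huc : ContinuousOn u (Icc 0 1) := fun x hx => (hu x hx).continuousWithinAt
  have huac := AbsolutelyContinuousOnInterval.of_hasDerivWithinAt zero_le_one hu hvc
  set M := ∫ t, ‖q t‖ ∂unitMeasure with hM
  have hM0 : 0 ≤ M := integral_nonneg fun _ => norm_nonneg _
  -- In the sup norm weighted by `exp (-κ x)`, the Volterra operator with kernel `(x - t) q t` has
  -- norm at most `M / κ`, because `x - t ≤ exp (κ (x - t)) / κ`. Hence any `κ > M` forces `u = 0`.
  set κ := 2 * M + 1 with hκ
  have hκ0 : 0 < κ := by positivity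
  -- Taylor's formula with integral remainder: `(x - t) v + u` has derivative `(x - t) v'` in `t`,
  -- and its value at `t = x` is `u x`.
  have hrep : ∀ x ∈ Icc (0 : ℝ) 1, u x = ∫ t in (0 : ℝ)..x, ((x - t : ℝ) : ℂ) * (q t * u t) := by
    intro x hx
    have hlin : AbsolutelyContinuousOnInterval (fun t : ℝ => ((x - t : ℝ) : ℂ)) 0 1 :=
      AbsolutelyContinuousOnInterval.ofReal
        (ContDiffOn.absolutelyContinuousOnInterval (contDiff_const.sub contDiff_id).contDiffOn)
    have hac : AbsolutelyContinuousOnInterval (fun t => ((x - t : ℝ) : ℂ) * v t + u t) 0 1 :=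
      (hlin.fun_smul hv).add huac
    have hd : ∀ᵐ t ∂unitMeasure, HasDerivAt (fun t => ((x - t : ℝ) : ℂ) * v t + u t)
        (((x - t : ℝ) : ℂ) * (q t * u t)) t := by
      filter_upwards [heq, ae_hasDerivAt_of_hasDerivWithinAt hu] with t h1 h2
      have h3 : HasDerivAt (fun t : ℝ => ((x - t : ℝ) : ℂ)) (((-1 : ℝ)) : ℂ) t :=
        ((hasDerivAt_id t).const_sub x).ofReal_comp
      refine ((h3.mul h1).add h2).congr_deriv ?_
      push_cast; ring
    have := AbsolutelyContinuousOnInterval.integral_eq_sub_complex_of_mem hx hac hd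
    rw [this]
    simp [hu0, hv0]
  obtain ⟨x₀, hx₀, hmax⟩ := isCompact_Icc.exists_isMaxOn (nonempty_Icc.2 zero_le_one)
    (f := fun x => ‖u x‖ * Real.exp (-(κ * x)))
    (huc.norm.mul (by fun_prop))
  set S := ‖u x₀‖ * Real.exp (-(κ * x₀)) with hS
  have hS0 : 0 ≤ S := by positivity
  have hle : ∀ t ∈ Icc (0 : ℝ) 1, ‖u t‖ ≤ S * Real.exp (κ * t) := by
    intro t ht
    have : ‖u t‖ * Real.exp (-(κ * t)) ≤ S := hmax ht
    calc ‖u t‖ = ‖u t‖ * Real.exp (-(κ * t)) * Real.exp (κ * t) := by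
          rw [mul_assoc, ← Real.exp_add]; simp
      _ ≤ _ := by gcongr
  have hbound : ‖u x₀‖ ≤ ∫ t in (0 : ℝ)..x₀, (S / κ * Real.exp (κ * x₀)) * ‖q t‖ := by
    rw [hrep x₀ hx₀]
    refine intervalIntegral.norm_integral_le_of_norm_le hx₀.1
      (Eventually.of_forall fun t ht => ?_) ?_
    · have ht1 : t ∈ Icc (0 : ℝ) 1 := ⟨ht.1.le, ht.2.trans hx₀.2⟩
      have hxt : 0 ≤ x₀ - t := by linarith [ht.2]
      rw [norm_mul, norm_mul, Complex.norm_real, Real.norm_of_nonneg hxt]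
      have h1 : κ * (x₀ - t) ≤ Real.exp (κ * (x₀ - t)) := by
        linarith [Real.add_one_le_exp (κ * (x₀ - t))]
      have h2 : (x₀ - t) ≤ Real.exp (κ * (x₀ - t)) / κ := by
        rw [le_div_iff₀ hκ0]; linarith
      calc (x₀ - t) * (‖q t‖ * ‖u t‖)
          ≤ (Real.exp (κ * (x₀ - t)) / κ) * (‖q t‖ * (S * Real.exp (κ * t))) := by
            gcongr; exact hle t ht1
        _ = S / κ * (Real.exp (κ * (x₀ - t)) * Real.exp (κ * t)) * ‖q t‖ := by ring
        _ = _ := by rw [← Real.exp_add]; ring_nf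
    · refine IntervalIntegrable.const_mul ?_ _
      refine (intervalIntegrable_of_integrable_unit hq.norm).mono_set ?_
      rw [uIcc_of_le hx₀.1, uIcc_of_le zero_le_one]
      exact Icc_subset_Icc_right hx₀.2
  have hS_le : S ≤ S / κ * M := by
    rw [intervalIntegral.integral_const_mul] at hbound
    have h1 := intervalIntegral_le_integral_unit hq.norm (fun _ => norm_nonneg _) hx₀
    calc S ≤ (S / κ * Real.exp (κ * x₀) * M) * Real.exp (-(κ * x₀)) := by
          rw [hS]; gcongr
          exact hbound.trans (by gcongr)
      _ = S / κ * M * (Real.exp (κ * x₀) * Real.exp (-(κ * x₀))) := by ring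
      _ = _ := by rw [← Real.exp_add]; simp
  have hSz : S = 0 := by
    have h1 : S * κ ≤ S * M := by
      have := mul_le_mul_of_nonneg_right hS_le hκ0.le
      rwa [show S / κ * M * κ = S * M by field_simp] at this
    nlinarith
  intro x hx
  have := hle x hx
  rw [hSz, zero_mul] at this
  exact norm_le_zero_iff.1 this

theorem integrable_ofReal_sub_const {V : ℝ → ℝ} (hV : Integrable V unitMeasure) (z : ℂ) :
    Integrable (fun x => (V x : ℂ) - z) unitMeasure :=
  hV.ofReal.sub (integrable_const z)

/-- The equation holds only almost everywhere, so the representative of `z • f` can be traded for `z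
* u`. What remains is a linear equation for the continuous function `u`. -/
theorem mem_eigenspace_iff {V : ℝ → ℝ} {z : ℂ} {f : L2} :
    f ∈ eigenspace (schrodingerOp V) z ↔ ∃ u v : ℝ → ℂ, (f : ℝ → ℂ) =ᵐ[unitMeasure] u ∧
      SolvesDirichlet V u v (fun x => z * u x) := by
  have : f ∈ eigenspace (schrodingerOp V) z ↔ (f, z • f) ∈ schrodingerGraph V := by
    rw [← schrodingerOp_graph]; rfl
  rw [this]
  refine exists_congr fun u => exists_congr fun v => and_congr_right fun hu => ?_
  constructor
  · rintro ⟨h1, h2, h3, h4, h5⟩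
    refine ⟨h1, h2, h3, h4, ?_⟩
    filter_upwards [h5, hu, Lp.coeFn_smul z f] with x h5 hu hz
    rw [← hu]
    convert h5 using 2
    · rw [hu]
    · exact hz.symm
  · rintro ⟨h1, h2, h3, h4, h5⟩
    refine ⟨h1, h2, h3, h4, ?_⟩
    filter_upwards [h5, hu, Lp.coeFn_smul z f] with x h5 hu hz
    convert h5 using 2
    rw [← hu]
    exact hz

theorem SolvesDirichlet.eqn_eigen {V : ℝ → ℝ} {u v : ℝ → ℂ} {z : ℂ}
    (h : SolvesDirichlet V u v (fun x => z * u x)) :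
    ∀ᵐ x ∂unitMeasure, HasDerivAt v (((V x : ℂ) - z) * u x) x := by
  filter_upwards [h.eqn] with x hx
  exact hx.congr_deriv (by ring)

/-- Two solutions of the eigenvalue equation vanishing at `0` are proportional. -/
theorem eigensolutions_proportional {V : ℝ → ℝ} (hV : Integrable V unitMeasure) {z : ℂ}
    {u v u' v' : ℝ → ℂ}
    (hu : ∀ x ∈ Icc (0 : ℝ) 1, HasDerivWithinAt u (v x) (Icc 0 1) x)
    (hv : AbsolutelyContinuousOnInterval v 0 1)
    (heq : ∀ᵐ x ∂unitMeasure, HasDerivAt v (((V x : ℂ) - z) * u x) x) (hu0 : u 0 = 0)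
    (hu' : ∀ x ∈ Icc (0 : ℝ) 1, HasDerivWithinAt u' (v' x) (Icc 0 1) x)
    (hv' : AbsolutelyContinuousOnInterval v' 0 1)
    (heq' : ∀ᵐ x ∂unitMeasure, HasDerivAt v' (((V x : ℂ) - z) * u' x) x) (hu0' : u' 0 = 0) :
    ∀ x ∈ Icc (0 : ℝ) 1, v 0 * u' x = v' 0 * u x := by
  have h1 : ∀ x ∈ Icc (0 : ℝ) 1, HasDerivWithinAt (fun x => v 0 * u' x - v' 0 * u x)
      (v 0 * v' x - v' 0 * v x) (Icc 0 1) x := fun x hx =>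
    ((hu' x hx).const_mul _).sub ((hu x hx).const_mul _)
  have h2 : AbsolutelyContinuousOnInterval (fun x => v 0 * v' x - v' 0 * v x) 0 1 :=
    (hv'.const_smul (v 0)).sub (hv.const_smul (v' 0))
  have h3 : ∀ᵐ x ∂unitMeasure, HasDerivAt (fun x => v 0 * v' x - v' 0 * v x)
      (((V x : ℂ) - z) * (v 0 * u' x - v' 0 * u x)) x := by
    filter_upwards [heq, heq'] with x h1 h2
    exact ((h2.const_mul (v 0)).sub (h1.const_mul (v' 0))).congr_deriv (by ring)
  intro x hx
  exact sub_eq_zero.1 (eq_zero_of_cauchy_data_eq_zero (integrable_ofReal_sub_const hV z) h1 h2 h3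
    (by simp [hu0, hu0']) (by ring) x hx)

theorem SolvesDirichlet.deriv_zero_ne_zero {V : ℝ → ℝ} (hV : Integrable V unitMeasure) {z : ℂ}
    {u v : ℝ → ℂ} (h : SolvesDirichlet V u v (fun x => z * u x)) {f : L2}
    (hf : (f : ℝ → ℂ) =ᵐ[unitMeasure] u) (hf0 : f ≠ 0) : v 0 ≠ 0 := by
  intro hv0
  apply hf0
  rw [Lp.eq_zero_iff_ae_eq_zero]
  have := eq_zero_of_cauchy_data_eq_zero (integrable_ofReal_sub_const hV z) h.hasDeriv h.absCont
    h.eqn_eigen h.left hv0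
  filter_upwards [hf, ae_restrict_mem measurableSet_Icc] with x h1 h2
  rw [h1, this x h2]; rfl

/-- Eigenspaces of Dirichlet Schrödinger operators are at most one-dimensional. -/
theorem eigenspace_eq_span {V : ℝ → ℝ} (hV : Integrable V unitMeasure) {z : ℂ} {f : L2}
    (hf : f ∈ eigenspace (schrodingerOp V) z) (hf0 : f ≠ 0) :
    eigenspace (schrodingerOp V) z = Submodule.span ℂ {f} := by
  refine le_antisymm ?_ ((Submodule.span_singleton_le_iff_mem _ _).2 hf)
  intro g hg
  obtain ⟨u, v, hu, h⟩ := mem_eigenspace_iff.1 hf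
  obtain ⟨u', v', hu', h'⟩ := mem_eigenspace_iff.1 hg
  have hv0 := h.deriv_zero_ne_zero hV hu hf0
  have hp := eigensolutions_proportional hV h.hasDeriv h.absCont h.eqn_eigen h.left
    h'.hasDeriv h'.absCont h'.eqn_eigen h'.left
  refine Submodule.mem_span_singleton.2 ⟨v' 0 / v 0, ?_⟩
  refine Lp.ext ?_
  filter_upwards [Lp.coeFn_smul (v' 0 / v 0) f, hu, hu', ae_restrict_mem measurableSet_Icc]
    with x h1 h2 h3 h4
  rw [h1, h3, Pi.smul_apply, h2, smul_eq_mul, div_mul_eq_mul_div, ← hp x h4]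
  field_simp

theorem finiteDimensional_eigenspace {V : ℝ → ℝ} (hV : Integrable V unitMeasure) (z : ℂ) :
    FiniteDimensional ℂ (eigenspace (schrodingerOp V) z) := by
  by_cases h : eigenspace (schrodingerOp V) z = ⊥
  · rw [h]; infer_instance
  · obtain ⟨f, hf, hf0⟩ := Submodule.exists_mem_ne_zero_of_ne_bot h
    rw [eigenspace_eq_span hV hf hf0]
    infer_instance

theorem finrank_eigenspace {V : ℝ → ℝ} (hV : Integrable V unitMeasure) {z : ℂ}
    (h : eigenspace (schrodingerOp V) z ≠ ⊥) :
    Module.finrank ℂ (eigenspace (schrodingerOp V) z) = 1 := by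
  obtain ⟨f, hf, hf0⟩ := Submodule.exists_mem_ne_zero_of_ne_bot h
  rw [eigenspace_eq_span hV hf hf0, finrank_span_singleton hf0]

/-! ### Symmetry and energy estimates -/

theorem hasDerivAt_conj {u : ℝ → ℂ} {w : ℂ} {x : ℝ} (h : HasDerivAt u w x) :
    HasDerivAt (fun y => starRingEnd ℂ (u y)) (starRingEnd ℂ w) x :=
  h.star

section Estimates

variable {V : ℝ → ℝ} {u v g : ℝ → ℂ}

theorem SolvesDirichlet.continuousOn_deriv (h : SolvesDirichlet V u v g) :
    ContinuousOn v (Icc 0 1) := by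
  simpa [uIcc_of_le zero_le_one] using h.absCont.continuousOn

theorem SolvesDirichlet.continuousOn (h : SolvesDirichlet V u v g) :
    ContinuousOn u (Icc 0 1) := fun x hx => (h.hasDeriv x hx).continuousWithinAt

theorem SolvesDirichlet.absCont_self (h : SolvesDirichlet V u v g) :
    AbsolutelyContinuousOnInterval u 0 1 :=
  AbsolutelyContinuousOnInterval.of_hasDerivWithinAt zero_le_one h.hasDeriv h.continuousOn_deriv

theorem inner_eq_integral (f g : L2) :
    inner ℂ f g = ∫ x, starRingEnd ℂ (f x) * g x ∂unitMeasure := by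
  rw [L2.inner_def]
  exact integral_congr_ae (Eventually.of_forall fun x => by simp [mul_comm])

theorem integrable_conj_mul (f g : L2) :
    Integrable (fun x => starRingEnd ℂ (f x) * g x) unitMeasure :=
  (L2.integrable_inner f g).congr (Eventually.of_forall fun x => by simp [mul_comm])

/-- The Dirichlet Schrödinger operator is symmetric. -/
theorem inner_symm_of_mem_graph {V : ℝ → ℝ} {p p' : L2 × L2} (hp : p ∈ schrodingerGraph V)
    (hp' : p' ∈ schrodingerGraph V) : inner ℂ p.1 p'.2 = inner ℂ p.2 p'.1 := by
  obtain ⟨u, v, hu, h⟩ := hp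
  obtain ⟨u', v', hu', h'⟩ := hp'
  -- Lagrange's identity: the real potential cancels in the derivative of this Wronskian, and the
  -- Dirichlet conditions kill its boundary values. Primes mark the second pair, not derivatives.
  have hac : AbsolutelyContinuousOnInterval
      (fun x => starRingEnd ℂ (u x) * v' x - starRingEnd ℂ (v x) * u' x) 0 1 :=
    (h.absCont_self.star.fun_smul h'.absCont).sub (h.absCont.star.fun_smul h'.absCont_self)
  have hd : ∀ᵐ x ∂unitMeasure, HasDerivAt
      (fun x => starRingEnd ℂ (u x) * v' x - starRingEnd ℂ (v x) * u' x)
      (starRingEnd ℂ (p.2 x) * p'.1 x - starRingEnd ℂ (p.1 x) * p'.2 x) x := by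
    filter_upwards [hu, hu', h.eqn, h'.eqn, ae_hasDerivAt_of_hasDerivWithinAt h.hasDeriv,
      ae_hasDerivAt_of_hasDerivWithinAt h'.hasDeriv] with x e1 e2 d1 d2 d3 d4
    refine (((hasDerivAt_conj d3).mul d2).sub ((hasDerivAt_conj d1).mul d4)).congr_deriv ?_
    rw [e1, e2]
    simp only [map_sub, map_mul, Complex.conj_ofReal]
    ring
  have := AbsolutelyContinuousOnInterval.integral_eq_sub_complex zero_le_one hac hd
  rw [← integral_unit_eq, integral_sub (integrable_conj_mul _ _) (integrable_conj_mul _ _),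
    ← inner_eq_integral, ← inner_eq_integral] at this
  simp only [h.left, h.right, h'.left, h'.right, map_zero, zero_mul, mul_zero, sub_self] at this
  exact (sub_eq_zero.1 this).symm

theorem norm_sq_eq_integral {f : L2} (hu : (f : ℝ → ℂ) =ᵐ[unitMeasure] u) :
    ‖f‖ ^ 2 = ∫ x, ‖u x‖ ^ 2 ∂unitMeasure := by
  have h1 : inner ℂ f f = ((‖f‖ ^ 2 : ℝ) : ℂ) := by
    rw [inner_self_eq_norm_sq_to_K]; push_cast; rfl
  have h2 : inner ℂ f f = ((∫ x, ‖u x‖ ^ 2 ∂unitMeasure : ℝ) : ℂ) := by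
    rw [inner_eq_integral, ← integral_complex_ofReal]
    refine integral_congr_ae ?_
    filter_upwards [hu] with x hx
    rw [hx, mul_comm, Complex.mul_conj, Complex.normSq_eq_norm_sq]
  exact_mod_cast h1.symm.trans h2

theorem integrable_norm_sq (hu : ContinuousOn u (Icc 0 1)) :
    Integrable (fun x => ‖u x‖ ^ 2) unitMeasure :=
  (hu.norm.pow 2).integrableOn_Icc

theorem integrable_mul_norm_sq (hV : Integrable V unitMeasure) (hu : ContinuousOn u (Icc 0 1)) :
    Integrable (fun x => V x * ‖u x‖ ^ 2) unitMeasure :=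
  IntegrableOn.mul_continuousOn hV (hu.norm.pow 2) isCompact_Icc

/-- The energy identity for the Dirichlet problem. -/
theorem energy_identity (hV : Integrable V unitMeasure) {f g : L2}
    (hu : (f : ℝ → ℂ) =ᵐ[unitMeasure] u) (h : SolvesDirichlet V u v g) :
    ∫ x, ‖v x‖ ^ 2 ∂unitMeasure + ∫ x, V x * ‖u x‖ ^ 2 ∂unitMeasure = (inner ℂ f g).re := by
  have hac : AbsolutelyContinuousOnInterval (fun x => starRingEnd ℂ (u x) * v x) 0 1 :=
    h.absCont_self.star.fun_smul h.absCont
  have hd : ∀ᵐ x ∂unitMeasure, HasDerivAt (fun x => starRingEnd ℂ (u x) * v x)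
      (((‖v x‖ ^ 2 + V x * ‖u x‖ ^ 2 : ℝ) : ℂ) - starRingEnd ℂ (f x) * g x) x := by
    filter_upwards [hu, h.eqn, ae_hasDerivAt_of_hasDerivWithinAt h.hasDeriv] with x e1 d1 d3
    refine ((hasDerivAt_conj d3).mul d1).congr_deriv ?_
    rw [e1]
    push_cast
    rw [← Complex.conj_mul', ← Complex.conj_mul']
    ring
  have h1 := integrable_norm_sq h.continuousOn_deriv
  have h2 := integrable_mul_norm_sq hV h.continuousOn
  have h12 : Integrable (fun x => ((‖v x‖ ^ 2 + V x * ‖u x‖ ^ 2 : ℝ) : ℂ)) unitMeasure :=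
    (h1.add h2).ofReal
  have := AbsolutelyContinuousOnInterval.integral_eq_sub_complex zero_le_one hac hd
  rw [← integral_unit_eq, integral_sub h12 (integrable_conj_mul _ _),
    ← inner_eq_integral] at this
  simp only [h.left, h.right, map_zero, zero_mul, sub_self] at this
  rw [← sub_eq_zero.1 this, integral_complex_ofReal, Complex.ofReal_re, integral_add h1 h2]

/-- `‖u‖²` starts from `0` and grows at rate at most `2 ‖u‖ ‖v‖ ≤ ε ‖v‖² + ε⁻¹ ‖u‖²`. The free
parameter `ε` serves to absorb the potential term in `exists_sup_bound`. -/
theorem norm_sq_le_integral (h : SolvesDirichlet V u v g) {ε : ℝ} (hε : 0 < ε) {x : ℝ}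
    (hx : x ∈ Icc (0 : ℝ) 1) :
    ‖u x‖ ^ 2 ≤ ε * ∫ x, ‖v x‖ ^ 2 ∂unitMeasure + ε⁻¹ * ∫ x, ‖u x‖ ^ 2 ∂unitMeasure := by
  have hac : AbsolutelyContinuousOnInterval (fun x => starRingEnd ℂ (u x) * u x) 0 1 :=
    h.absCont_self.star.fun_smul h.absCont_self
  have hd : ∀ᵐ x ∂unitMeasure, HasDerivAt (fun x => starRingEnd ℂ (u x) * u x)
      (starRingEnd ℂ (v x) * u x + starRingEnd ℂ (u x) * v x) x := by
    filter_upwards [ae_hasDerivAt_of_hasDerivWithinAt h.hasDeriv] with x d3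
    exact (hasDerivAt_conj d3).mul d3
  have h1 := AbsolutelyContinuousOnInterval.integral_eq_sub_complex_of_mem hx hac hd
  rw [h.left, mul_zero, sub_zero, Complex.conj_mul'] at h1
  have hi : Integrable (fun x => ε * ‖v x‖ ^ 2 + ε⁻¹ * ‖u x‖ ^ 2) unitMeasure :=
    ((integrable_norm_sq h.continuousOn_deriv).const_mul _).add
      ((integrable_norm_sq h.continuousOn).const_mul _)
  have h2 : ‖∫ t in (0 : ℝ)..x, (starRingEnd ℂ (v t) * u t + starRingEnd ℂ (u t) * v t)‖ ≤
      ∫ t in (0 : ℝ)..x, (ε * ‖v t‖ ^ 2 + ε⁻¹ * ‖u t‖ ^ 2) := by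
    refine intervalIntegral.norm_integral_le_of_norm_le hx.1
      (Eventually.of_forall fun t _ => ?_) ?_
    · refine (norm_add_le _ _).trans ?_
      rw [norm_mul, norm_mul, RCLike.norm_conj, RCLike.norm_conj]
      have : 0 ≤ ε⁻¹ * (ε * ‖v t‖ - ‖u t‖) ^ 2 := by positivity
      have e : ε⁻¹ * (ε * ‖v t‖ - ‖u t‖) ^ 2 =
          ε * ‖v t‖ ^ 2 + ε⁻¹ * ‖u t‖ ^ 2 - (‖v t‖ * ‖u t‖ + ‖u t‖ * ‖v t‖) := by
        field_simp; ring
      linarith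
    · refine (intervalIntegrable_of_integrable_unit hi).mono_set ?_
      rw [uIcc_of_le hx.1, uIcc_of_le zero_le_one]
      exact Icc_subset_Icc_right hx.2
  rw [h1, norm_pow, Complex.norm_real, norm_norm] at h2
  refine (h2.trans (intervalIntegral_le_integral_unit hi (fun _ => by positivity) hx)).trans ?_
  rw [integral_add ((integrable_norm_sq h.continuousOn_deriv).const_mul _)
      ((integrable_norm_sq h.continuousOn).const_mul _), integral_const_mul, integral_const_mul]

/-- Functions of bounded energy are bounded by their `L²` norm. -/
theorem exists_sup_bound (hV : Integrable V unitMeasure) {K : ℝ} (hK : 0 ≤ K) :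
    ∃ C : ℝ, 0 ≤ C ∧ ∀ (f g : L2) (u v : ℝ → ℂ), (f : ℝ → ℂ) =ᵐ[unitMeasure] u →
      SolvesDirichlet V u v g → (inner ℂ f g).re ≤ K * ‖f‖ ^ 2 →
      ∀ x ∈ Icc (0 : ℝ) 1, ‖u x‖ ^ 2 ≤ C * ‖f‖ ^ 2 := by
  set M := ∫ t, ‖V t‖ ∂unitMeasure with hM
  have hM0 : 0 ≤ M := integral_nonneg fun _ => norm_nonneg _
  -- The energy identity bounds `∫ ‖v‖²` by `K ‖f‖² + M max ‖u‖²`. As `ε M ≤ 1/2`, the term `ε M max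
  -- ‖u‖²` is absorbed into the left side, which leaves the constant `2 (ε K + ε⁻¹)`.
  set ε : ℝ := (2 * M + 1)⁻¹ with hε
  have hε0 : 0 < ε := by positivity
  have hεM : ε * M ≤ 1 / 2 := by
    rw [hε, inv_mul_le_iff₀ (by positivity)]; linarith
  refine ⟨2 * (ε * K + ε⁻¹), by positivity, fun f g u v hu h hle x hx => ?_⟩
  obtain ⟨x₀, hx₀, hmax⟩ := isCompact_Icc.exists_isMaxOn (nonempty_Icc.2 zero_le_one)
    (f := fun x => ‖u x‖ ^ 2) (h.continuousOn.norm.pow 2)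
  have hmax' : ∀ y ∈ Icc (0 : ℝ) 1, ‖u y‖ ^ 2 ≤ ‖u x₀‖ ^ 2 := fun y hy => hmax hy
  refine (hmax' x hx).trans ?_
  have h1 := norm_sq_le_integral h hε0 hx₀
  have h2 := energy_identity hV hu h
  have h3 : -∫ x, V x * ‖u x‖ ^ 2 ∂unitMeasure ≤ M * ‖u x₀‖ ^ 2 := by
    rw [← integral_neg, hM, ← integral_mul_const]
    refine integral_mono_ae (integrable_mul_norm_sq hV h.continuousOn).neg
      (hV.norm.mul_const _) ?_
    filter_upwards [ae_restrict_mem measurableSet_Icc] with y hy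
    have h4 : -V y ≤ ‖V y‖ := by rw [Real.norm_eq_abs]; exact neg_le_abs _
    calc -(V y * ‖u y‖ ^ 2) = -V y * ‖u y‖ ^ 2 := by ring
      _ ≤ ‖V y‖ * ‖u y‖ ^ 2 := by gcongr
      _ ≤ ‖V y‖ * ‖u x₀‖ ^ 2 := by gcongr ?_ * ?_; exact hmax' y hy
  rw [← norm_sq_eq_integral hu] at h1
  have h5 : ∫ x, ‖v x‖ ^ 2 ∂unitMeasure ≤ K * ‖f‖ ^ 2 + M * ‖u x₀‖ ^ 2 := by linarith
  have h6 := mul_le_mul_of_nonneg_left h5 hε0.le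
  have h7 := mul_le_mul_of_nonneg_right hεM (sq_nonneg ‖u x₀‖)
  linarith

end Estimates

/-! ### Reality of the eigenvalues and finiteness below a level -/

theorem mem_graph_of_mem_eigenspace {V : ℝ → ℝ} {z : ℂ} {f : L2}
    (hf : f ∈ eigenspace (schrodingerOp V) z) : (f, z • f) ∈ schrodingerGraph V := by
  rw [← schrodingerOp_graph]; exact hf

/-- The eigenvalues of a Dirichlet Schrödinger operator are real. -/
theorem eigenvalue_real {V : ℝ → ℝ} {z : ℂ} (hz : eigenspace (schrodingerOp V) z ≠ ⊥) :
    ((z.re : ℝ) : ℂ) = z := by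
  obtain ⟨f, hf, hf0⟩ := Submodule.exists_mem_ne_zero_of_ne_bot hz
  have h := inner_symm_of_mem_graph (mem_graph_of_mem_eigenspace hf)
    (mem_graph_of_mem_eigenspace hf)
  simp only [inner_smul_left, inner_smul_right] at h
  exact (Complex.conj_eq_iff_re.1 (mul_right_cancel₀ (inner_self_ne_zero.2 hf0) h.symm))

theorem inner_eq_zero_of_eigenvalue_ne {V : ℝ → ℝ} {a b : ℝ} (hab : a ≠ b) {f g : L2}
    (hf : f ∈ eigenspace (schrodingerOp V) (a : ℂ))
    (hg : g ∈ eigenspace (schrodingerOp V) (b : ℂ)) : inner ℂ f g = 0 := by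
  have h := inner_symm_of_mem_graph (mem_graph_of_mem_eigenspace hf)
    (mem_graph_of_mem_eigenspace hg)
  simp only [inner_smul_left, inner_smul_right, Complex.conj_ofReal] at h
  have h' : ((b : ℂ) - a) * inner ℂ f g = 0 := by linear_combination h
  rcases mul_eq_zero.1 h' with h' | h'
  · exact absurd (Complex.ofReal_injective (sub_eq_zero.1 h')).symm hab
  · exact h'

/-- The number of eigenvalues below a given level is bounded. -/
theorem exists_card_eigenvalue_le {V : ℝ → ℝ} (hV : Integrable V unitMeasure) {K : ℝ}
    (hK : 0 ≤ K) : ∃ C : ℝ, ∀ s : Finset ℝ,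
      (∀ a ∈ s, a ≤ K ∧ eigenspace (schrodingerOp V) (a : ℂ) ≠ ⊥) → (s.card : ℝ) ≤ C := by
  obtain ⟨C, hC0, hC⟩ := exists_sup_bound hV hK
  refine ⟨C, fun s hs => ?_⟩
  have hex : ∀ a : s, ∃ f : L2, f ∈ eigenspace (schrodingerOp V) ((a : ℝ) : ℂ) ∧ ‖f‖ = 1 := by
    intro a
    obtain ⟨f, hf, hf0⟩ := Submodule.exists_mem_ne_zero_of_ne_bot (hs a a.2).2
    exact ⟨((‖f‖⁻¹ : ℝ) : ℂ) • f, Submodule.smul_mem _ _ hf, by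
      rw [norm_smul, Complex.norm_real, norm_inv, norm_norm, inv_mul_cancel₀ (norm_ne_zero_iff.2 hf0)]⟩
  choose f hf hf1 using hex
  have hon : Orthonormal ℂ f := ⟨hf1, fun a b hab =>
    inner_eq_zero_of_eigenvalue_ne (fun h => hab (Subtype.ext h)) (hf a) (hf b)⟩
  have hex2 : ∀ a : s, ∃ u v : ℝ → ℂ, (f a : ℝ → ℂ) =ᵐ[unitMeasure] u ∧
      SolvesDirichlet V u v (((a : ℝ) : ℂ) • f a : L2) := fun a =>
    mem_graph_of_mem_eigenspace (hf a)
  choose u v hu huv using hex2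
  have key : ∀ x ∈ Icc (0 : ℝ) 1, ∑ a, ‖u a x‖ ^ 2 ≤ C := by
    intro x hx
    -- The extremal test vector `p = ∑ conj (u a x) f a`: both its squared norm and its value at `x`
    -- equal `T = ∑ ‖u a x‖²`. Its energy is at most `K ‖p‖²` by orthonormality, so the sup bound
    -- reads `T² ≤ C T`.
    set c : s → ℂ := fun a => starRingEnd ℂ (u a x) with hc
    have hmem : ∑ a, c a • ((f a, ((a : ℝ) : ℂ) • f a) : L2 × L2) ∈ schrodingerGraph V :=
      Submodule.sum_mem _ fun a _ => Submodule.smul_mem _ _ (mem_graph_of_mem_eigenspace (hf a))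
    set p := ∑ a, c a • ((f a, ((a : ℝ) : ℂ) • f a) : L2 × L2) with hp
    have hp1 : p.1 = ∑ a, c a • f a := by rw [hp, Prod.fst_sum]; rfl
    have hp2 : p.2 = ∑ a, (c a * ((a : ℝ) : ℂ)) • f a := by
      rw [hp, Prod.snd_sum]
      exact Finset.sum_congr rfl fun a _ => smul_smul _ _ _
    have hcc : ∀ a, starRingEnd ℂ (c a) * c a = ((‖u a x‖ ^ 2 : ℝ) : ℂ) := fun a => by
      rw [hc]; simp [Complex.mul_conj']
    have hn : ‖p.1‖ ^ 2 = ∑ a, ‖u a x‖ ^ 2 := by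
      have h1 : inner ℂ p.1 p.1 = ((‖p.1‖ ^ 2 : ℝ) : ℂ) := by
        rw [inner_self_eq_norm_sq_to_K]; push_cast; rfl
      rw [hp1, hon.inner_sum, Finset.sum_congr rfl fun a _ => hcc a, ← Complex.ofReal_sum,
        ← hp1] at h1
      exact_mod_cast h1.symm
    have hin : (inner ℂ p.1 p.2).re ≤ K * ‖p.1‖ ^ 2 := by
      have h1 : inner ℂ p.1 p.2 = ((∑ a : s, ‖u a x‖ ^ 2 * (a : ℝ) : ℝ) : ℂ) := by
        rw [hp1, hp2, hon.inner_sum, Complex.ofReal_sum]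
        exact Finset.sum_congr rfl fun a _ => by rw [← mul_assoc, hcc]; push_cast; rfl
      rw [h1, Complex.ofReal_re, hn, Finset.mul_sum]
      refine Finset.sum_le_sum fun a _ => ?_
      rw [mul_comm]
      exact mul_le_mul_of_nonneg_right (hs a a.2).1 (by positivity)
    obtain ⟨w, w', hw, hww⟩ := hmem
    have hb := hC p.1 p.2 w w' hw hww hin x hx
    have hwx : w x = ∑ a, c a * u a x := by
      have hae : w =ᵐ[unitMeasure] fun y => ∑ a, c a * u a y := by
        have h1 : (p.1 : ℝ → ℂ) =ᵐ[unitMeasure] fun y => ∑ a, c a * u a y := by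
          rw [hp1]
          have h2 : ∀ᵐ y ∂unitMeasure, ∀ a, (c a • f a : L2) y = c a * u a y := by
            rw [ae_all_iff]
            intro a
            filter_upwards [Lp.coeFn_smul (c a) (f a), hu a] with y h3 h4
            rw [h3, Pi.smul_apply, h4, smul_eq_mul]
          have h5 := Lp.coeFn_finsetSum Finset.univ (fun a => c a • f a)
          filter_upwards [h2, h5] with y h2 h5
          rw [h5, Finset.sum_apply]
          exact Finset.sum_congr rfl fun a _ => h2 a
        exact hw.symm.trans h1
      exact Measure.eqOn_Icc_of_ae_eq volume zero_ne_one hae hww.continuousOn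
        (continuousOn_finsetSum _ fun a _ => continuousOn_const.mul (huv a).continuousOn) hx
    have hwx' : w x = ((∑ a, ‖u a x‖ ^ 2 : ℝ) : ℂ) := by
      rw [hwx, Complex.ofReal_sum]
      exact Finset.sum_congr rfl fun a _ => by rw [hc]; simp [Complex.conj_mul']
    have hT : 0 ≤ ∑ a, ‖u a x‖ ^ 2 := Finset.sum_nonneg fun _ _ => by positivity
    rw [hn, hwx', Complex.norm_real, Real.norm_of_nonneg hT] at hb
    by_contra hcon
    push Not at hcon
    nlinarith
  -- Integrating the pointwise bound counts the eigenvalues, as each normalized eigenfunction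
  -- contributes `1`.
  have hint : ∫ x, ∑ a, ‖u a x‖ ^ 2 ∂unitMeasure = s.card := by
    rw [integral_finsetSum _ fun a _ => integrable_norm_sq (huv a).continuousOn]
    rw [Finset.sum_congr rfl fun a _ => (norm_sq_eq_integral (hu a)).symm]
    simp [hf1]
  rw [← hint]
  calc ∫ x, ∑ a, ‖u a x‖ ^ 2 ∂unitMeasure ≤ ∫ _x, C ∂unitMeasure := by
        refine integral_mono_ae (integrable_finsetSum _ fun a _ =>
          integrable_norm_sq (huv a).continuousOn) (integrable_const C) ?_
        filter_upwards [ae_restrict_mem measurableSet_Icc] with x hx using key x hx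
    _ = C := by simp

/-- A Dirichlet Schrödinger operator has finitely many eigenvalues below a given level. -/
theorem finite_eigenvalue_le {V : ℝ → ℝ} (hV : Integrable V unitMeasure) (K : ℝ) :
    {a : ℝ | a ≤ K ∧ eigenspace (schrodingerOp V) (a : ℂ) ≠ ⊥}.Finite := by
  by_contra hinf
  obtain ⟨C, hC⟩ := exists_card_eigenvalue_le hV (le_max_left 0 K)
  obtain ⟨n, hn⟩ := exists_nat_gt C
  obtain ⟨t, ht, hcard⟩ := Set.Infinite.exists_subset_card_eq hinf n
  have := hC t fun a ha => ⟨(ht ha).1.trans (le_max_right _ _), (ht ha).2⟩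
  rw [hcard] at this
  linarith

end DirichletSchrodinger

/-! ### The modified Prüfer phase -/

/-- A continuously differentiable function of an absolutely continuous function is absolutely
continuous. -/
theorem AbsolutelyContinuousOnInterval.contDiff_comp {f φ : ℝ → ℝ} {a b : ℝ}
    (hf : AbsolutelyContinuousOnInterval f a b) (hφ : ContDiff ℝ 1 φ) :
    AbsolutelyContinuousOnInterval (fun x => φ (f x)) a b := by
  obtain ⟨C, hC⟩ := hf.exists_bound
  obtain ⟨K, hK⟩ := (hφ.contDiffOn (s := Icc (-C) C)).exists_lipschitzOnWith (by decide)
    (convex_Icc _ _) isCompact_Icc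
  have hmem : ∀ x ∈ uIcc a b, f x ∈ Icc (-C) C := fun x hx => abs_le.1 (hC x hx)
  unfold AbsolutelyContinuousOnInterval at hf ⊢
  refine squeeze_zero' (Eventually.of_forall fun E => Finset.sum_nonneg fun _ _ => dist_nonneg) ?_
    (by simpa using hf.const_mul (K : ℝ))
  rw [eventually_inf_principal]
  filter_upwards with E hE
  rw [Finset.mul_sum]
  exact Finset.sum_le_sum fun i hi =>
    hK.dist_le_mul _ (hmem _ (hE.1 i hi).1) _ (hmem _ (hE.1 i hi).2)

namespace DirichletSchrodinger

/-- `η` is the deviation from `k x` of the modified Prüfer phase of `u'' = (W - k²) u`,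
`u 0 = 0`. -/
structure IsPhase (W : ℝ → ℝ) (k : ℝ) (η : ℝ → ℝ) : Prop where
  continuous : Continuous η
  eqn : ∀ x, η x = -k⁻¹ * ∫ t in (0 : ℝ)..x, W t * Real.sin (k * t + η t) ^ 2

section Phase

variable {W : ℝ → ℝ}

theorem integrable_mul_of_le_one (hW : Integrable W) {F : ℝ → ℝ} (hF : Continuous F) (h1 : ∀ x, |F x| ≤ 1) :
    Integrable (fun x => W x * F x) :=
  hW.mul_bdd (c := 1) hF.aestronglyMeasurable (Eventually.of_forall h1)

theorem abs_intervalIntegral_mul_le (hW : Integrable W) {F : ℝ → ℝ} {c : ℝ} (hc : 0 ≤ c) {x : ℝ}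
    (h1 : ∀ t ∈ uIoc 0 x, |F t| ≤ c) :
    |∫ t in (0 : ℝ)..x, W t * F t| ≤ c * ∫ t, ‖W t‖ := by
  rw [← Real.norm_eq_abs, ← integral_const_mul]
  refine (intervalIntegral.norm_integral_le_abs_of_norm_le (g := fun t => c * ‖W t‖) ?_ ?_).trans ?_
  · refine (ae_restrict_iff' measurableSet_uIoc).2 (Eventually.of_forall fun t ht => ?_)
    rw [norm_mul, mul_comm]
    exact mul_le_mul_of_nonneg_right (h1 t ht) (norm_nonneg _)
  · exact (hW.norm.const_mul c).intervalIntegrable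
  · rw [intervalIntegral.abs_integral_eq_abs_integral_uIoc, abs_of_nonneg
      (integral_nonneg fun _ => by positivity)]
    exact setIntegral_le_integral (hW.norm.const_mul c) (Eventually.of_forall fun _ => by positivity)

theorem abs_sin_sq_sub_sin_sq_le (a b : ℝ) : |Real.sin a ^ 2 - Real.sin b ^ 2| ≤ |a - b| := by
  have e : Real.sin a ^ 2 - Real.sin b ^ 2 = Real.sin (a - b) * Real.sin (a + b) := by
    rw [Real.sin_sub, Real.sin_add]
    have h1 := Real.sin_sq_add_cos_sq a
    have h2 := Real.sin_sq_add_cos_sq b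
    linear_combination Real.sin b ^ 2 * h1 - Real.sin a ^ 2 * h2
  rw [e, abs_mul]
  calc |Real.sin (a - b)| * |Real.sin (a + b)| ≤ |a - b| * 1 :=
        mul_le_mul Real.abs_sin_le_abs (Real.abs_sin_le_one _) (abs_nonneg _) (abs_nonneg _)
    _ = _ := mul_one _

theorem abs_sin_sq_le_one (a : ℝ) : |Real.sin a ^ 2| ≤ 1 := by
  rw [abs_pow]; exact pow_le_one₀ (abs_nonneg _) (Real.abs_sin_le_one _)

/-- Banach's fixed point theorem on the bounded continuous functions on `ℝ`: since `sin²` is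
1-Lipschitz, the integral operator has Lipschitz constant `M / k < 1`, with `M` the `L¹` norm of
`W`. -/
theorem exists_phase (hW : Integrable W) {k : ℝ} (hk : ∫ t, ‖W t‖ < k) : ∃ η, IsPhase W k η := by
  set M := ∫ t, ‖W t‖ with hM
  have hM0 : 0 ≤ M := integral_nonneg fun _ => norm_nonneg _
  have hk0 : 0 < k := hM0.trans_lt hk
  have hint : ∀ η : BoundedContinuousFunction ℝ ℝ,
      Integrable fun t => W t * Real.sin (k * t + η t) ^ 2 := fun η =>
    integrable_mul_of_le_one hW (by fun_prop) fun _ => abs_sin_sq_le_one _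
  let T : BoundedContinuousFunction ℝ ℝ → BoundedContinuousFunction ℝ ℝ := fun η =>
    BoundedContinuousFunction.ofNormedAddCommGroup
      (fun x => -k⁻¹ * ∫ t in (0 : ℝ)..x, W t * Real.sin (k * t + η t) ^ 2)
      (continuous_const.mul ((hint η).continuous_primitive 0)) (k⁻¹ * M) (fun x => by
        rw [norm_mul, norm_neg, norm_inv, Real.norm_of_nonneg hk0.le]
        gcongr
        simpa [hM] using abs_intervalIntegral_mul_le hW zero_le_one (x := x)
          (F := fun t => Real.sin (k * t + η t) ^ 2) fun t _ => abs_sin_sq_le_one _)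
  have hT : ∀ η x, T η x = -k⁻¹ * ∫ t in (0 : ℝ)..x, W t * Real.sin (k * t + η t) ^ 2 :=
    fun _ _ => rfl
  have hcoe : ((M / k).toNNReal : ℝ) = M / k := Real.coe_toNNReal _ (by positivity)
  have hc : ContractingWith (M / k).toNNReal T := by
    refine ⟨?_, LipschitzWith.of_dist_le_mul fun η₁ η₂ => ?_⟩
    · rw [← NNReal.coe_lt_coe, hcoe]
      exact (div_lt_one hk0).2 hk
    · rw [hcoe, BoundedContinuousFunction.dist_le (by positivity)]
      intro x
      rw [hT, hT, Real.dist_eq, ← mul_sub, ← intervalIntegral.integral_sub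
        (hint η₁).intervalIntegrable (hint η₂).intervalIntegrable, abs_mul, abs_neg,
        abs_of_pos (inv_pos.2 hk0)]
      simp_rw [← mul_sub]
      have := abs_intervalIntegral_mul_le hW dist_nonneg (x := x) (c := dist η₁ η₂)
        (F := fun t => Real.sin (k * t + η₁ t) ^ 2 - Real.sin (k * t + η₂ t) ^ 2) fun t _ => by
          refine (abs_sin_sq_sub_sin_sq_le _ _).trans ?_
          rw [add_sub_add_left_eq_sub, ← Real.dist_eq]
          exact BoundedContinuousFunction.dist_coe_le_dist t
      calc k⁻¹ * _ ≤ k⁻¹ * (dist η₁ η₂ * M) := by gcongr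
        _ = M / k * dist η₁ η₂ := by ring
  obtain ⟨η, hη⟩ : ∃ η, T η = η := ⟨_, hc.fixedPoint_isFixedPt⟩
  refine ⟨η, η.continuous, fun x => ?_⟩
  rw [← hT, hη]

theorem IsPhase.abs_le (hW : Integrable W) {k : ℝ} (hk : 0 < k) {η : ℝ → ℝ} (h : IsPhase W k η) (x : ℝ) :
    |η x| ≤ (∫ t, ‖W t‖) / k := by
  rw [h.eqn, abs_mul, abs_neg, abs_of_pos (inv_pos.2 hk), div_eq_inv_mul]
  gcongr
  simpa using abs_intervalIntegral_mul_le hW zero_le_one (x := x)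
    (F := fun t => Real.sin (k * t + η t) ^ 2) fun t _ => abs_sin_sq_le_one _

/-- With `δ = |k₁ - k₂|` and `S` the maximum of `|η₁ - η₂|` on `[0,1]`, subtracting the phase
equations gives `S ≤ k₁⁻¹ M (δ + S) + k₁⁻¹ k₂⁻¹ M δ`. The threshold `8 (M + 1)` makes the
coefficients at most `1/8` and `1/64`. Any Lipschitz constant below `1` would make `k + η 1`
injective in `k`. -/
theorem IsPhase.lipschitz (hW : Integrable W) {k₁ k₂ : ℝ} (hk₁ : 8 * ((∫ t, ‖W t‖) + 1) ≤ k₁)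
    (hk₂ : 8 * ((∫ t, ‖W t‖) + 1) ≤ k₂) {η₁ η₂ : ℝ → ℝ} (h₁ : IsPhase W k₁ η₁)
    (h₂ : IsPhase W k₂ η₂) : |η₁ 1 - η₂ 1| ≤ 1 / 2 * |k₁ - k₂| := by
  set M := ∫ t, ‖W t‖ with hM
  have hM0 : 0 ≤ M := integral_nonneg fun _ => norm_nonneg _
  have hp₁ : 0 < k₁ := by linarith
  have hp₂ : 0 < k₂ := by linarith
  obtain ⟨x₀, hx₀, hmax⟩ := isCompact_Icc.exists_isMaxOn (nonempty_Icc.2 zero_le_one)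
    (f := fun x => |η₁ x - η₂ x|) ((h₁.continuous.sub h₂.continuous).abs.continuousOn)
  set S := |η₁ x₀ - η₂ x₀| with hS
  have hmax' : ∀ y ∈ Icc (0 : ℝ) 1, |η₁ y - η₂ y| ≤ S := fun y hy => hmax hy
  set δ := |k₁ - k₂| with hδ
  have hδ0 : 0 ≤ δ := abs_nonneg _
  have hS0 : 0 ≤ S := abs_nonneg _
  have hi₁ : Integrable fun t => W t * Real.sin (k₁ * t + η₁ t) ^ 2 :=
    integrable_mul_of_le_one hW (by have := h₁.continuous; fun_prop) fun _ => abs_sin_sq_le_one _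
  have hi₂ : Integrable fun t => W t * Real.sin (k₂ * t + η₂ t) ^ 2 :=
    integrable_mul_of_le_one hW (by have := h₂.continuous; fun_prop) fun _ => abs_sin_sq_le_one _
  have hrep : η₁ x₀ - η₂ x₀ = ∫ t in (0 : ℝ)..x₀,
      W t * (k₂⁻¹ * Real.sin (k₂ * t + η₂ t) ^ 2 - k₁⁻¹ * Real.sin (k₁ * t + η₁ t) ^ 2) := by
    rw [h₁.eqn, h₂.eqn, neg_mul, neg_mul, neg_sub_neg, ← intervalIntegral.integral_const_mul,
      ← intervalIntegral.integral_const_mul, ← intervalIntegral.integral_sub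
        (hi₂.const_mul _).intervalIntegrable (hi₁.const_mul _).intervalIntegrable]
    congr 1; ext t; ring
  have hle : S ≤ (k₁⁻¹ * (δ + S) + k₁⁻¹ * k₂⁻¹ * δ) * M := by
    have hrepS : S = _ := congrArg abs hrep
    refine hrepS.le.trans ?_
    refine abs_intervalIntegral_mul_le hW (by positivity) fun t ht => ?_
    rw [uIoc_of_le hx₀.1] at ht
    have ht1 : t ∈ Icc (0 : ℝ) 1 := ⟨ht.1.le, ht.2.trans hx₀.2⟩
    have e : k₂⁻¹ * Real.sin (k₂ * t + η₂ t) ^ 2 - k₁⁻¹ * Real.sin (k₁ * t + η₁ t) ^ 2 =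
        k₁⁻¹ * (Real.sin (k₂ * t + η₂ t) ^ 2 - Real.sin (k₁ * t + η₁ t) ^ 2) +
        k₁⁻¹ * k₂⁻¹ * (k₁ - k₂) * Real.sin (k₂ * t + η₂ t) ^ 2 := by
      field_simp; ring
    rw [e]
    refine (abs_add_le _ _).trans (add_le_add ?_ ?_)
    · rw [abs_mul, abs_of_pos (inv_pos.2 hp₁)]
      gcongr
      refine (abs_sin_sq_sub_sin_sq_le _ _).trans ?_
      have e2 : k₂ * t + η₂ t - (k₁ * t + η₁ t) = -((k₁ - k₂) * t + (η₁ t - η₂ t)) := by ring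
      rw [e2, abs_neg]
      refine (abs_add_le _ _).trans (add_le_add ?_ (hmax' t ht1))
      rw [abs_mul, abs_of_nonneg ht1.1]
      exact mul_le_of_le_one_right hδ0 ht1.2
    · rw [abs_mul, abs_mul, abs_of_pos (by positivity : 0 < k₁⁻¹ * k₂⁻¹)]
      exact mul_le_of_le_one_right (by positivity) (abs_sin_sq_le_one _)
  have h1 : k₁⁻¹ * M ≤ 1 / 8 := by rw [inv_mul_le_iff₀ hp₁]; linarith
  have h2 : k₂⁻¹ ≤ 1 / 8 := by
    rw [one_div]; exact inv_anti₀ (by norm_num) (by linarith)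
  have h3 : k₁⁻¹ * M * (δ + S) ≤ 1 / 8 * (δ + S) := by gcongr
  have h4 : k₁⁻¹ * M * (k₂⁻¹ * δ) ≤ 1 / 8 * (1 / 8 * δ) := by gcongr
  have h5 := hmax' 1 (right_mem_Icc.2 zero_le_one)
  linarith

theorem ae_hasDerivAt_primitive (hW : Integrable W) {F : ℝ → ℝ} (hF : Continuous F) (h1 : ∀ x, |F x| ≤ 1) :
    ∀ᵐ x ∂unitMeasure, HasDerivAt (fun x => ∫ t in (0 : ℝ)..x, W t * F t) (W x * F x) x := by
  have := LocallyIntegrable.ae_hasDerivAt_integral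
    (integrable_mul_of_le_one hW hF h1).locallyIntegrable
  exact ae_restrict_of_ae (this.mono fun x hx => hx 0)

theorem absCont_primitive (hW : Integrable W) {F : ℝ → ℝ} (hF : Continuous F) (h1 : ∀ x, |F x| ≤ 1) :
    AbsolutelyContinuousOnInterval (fun x => ∫ t in (0 : ℝ)..x, W t * F t) 0 1 :=
  ((integrable_mul_of_le_one hW hF h1).intervalIntegrable
    ).absolutelyContinuousOnInterval_intervalIntegral left_mem_uIcc

/-- The solution of the initial value problem reconstructed from its Prüfer phase. -/
theorem IsPhase.exists_solution (hW : Integrable W) {k : ℝ} (hk : 0 < k) {η : ℝ → ℝ} (h : IsPhase W k η) :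
    ∃ u v : ℝ → ℂ, (∀ x ∈ Icc (0 : ℝ) 1, HasDerivWithinAt u (v x) (Icc 0 1) x) ∧
      AbsolutelyContinuousOnInterval v 0 1 ∧
      (∀ᵐ x ∂unitMeasure, HasDerivAt v (((W x : ℂ) - (k : ℂ) ^ 2) * u x) x) ∧
      u 0 = 0 ∧ v 0 = 1 ∧ (u 1 = 0 ↔ Real.sin (k + η 1) = 0) := by
  have hηc := h.continuous
  set θ : ℝ → ℝ := fun x => k * x + η x with hθ
  have hθc : Continuous θ := by fun_prop
  -- For `u = k⁻¹ r sin θ` and `v = r cos θ`, the system `u' = v`, `v' = (W - k²) u` follows from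
  -- `θ' = k - k⁻¹ W sin² θ` and `r' / r = k⁻¹ W sin θ cos θ`. Thus `A` is `k log r`.
  set A : ℝ → ℝ := fun x => ∫ t in (0 : ℝ)..x, W t * (Real.sin (θ t) * Real.cos (θ t)) with hA
  have hsc : ∀ x, |Real.sin (θ x) * Real.cos (θ x)| ≤ 1 := fun x => by
    rw [abs_mul]
    exact mul_le_one₀ (Real.abs_sin_le_one _) (abs_nonneg _) (Real.abs_cos_le_one _)
  have hscc : Continuous fun x => Real.sin (θ x) * Real.cos (θ x) := by fun_prop
  have hAc : Continuous A := (integrable_mul_of_le_one hW hscc hsc).continuous_primitive 0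
  have hAac : AbsolutelyContinuousOnInterval A 0 1 := absCont_primitive hW hscc hsc
  have hs2c : Continuous fun x => Real.sin (θ x) ^ 2 := by fun_prop
  have hηac : AbsolutelyContinuousOnInterval η 0 1 := by
    have := (absCont_primitive hW hs2c fun _ => abs_sin_sq_le_one _).const_mul (-k⁻¹)
    exact (funext h.eqn : η = _) ▸ this
  have hθac : AbsolutelyContinuousOnInterval θ 0 1 :=
    (ContDiffOn.absolutelyContinuousOnInterval
      ((contDiff_const.mul contDiff_id).contDiffOn : ContDiffOn ℝ 1 (fun x : ℝ => k * x) _)).add hηac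
  have hAd := ae_hasDerivAt_primitive hW hscc hsc
  have hθd : ∀ᵐ x ∂unitMeasure, HasDerivAt θ (k - k⁻¹ * (W x * Real.sin (θ x) ^ 2)) x := by
    filter_upwards [ae_hasDerivAt_primitive hW hs2c fun _ => abs_sin_sq_le_one _] with x hx
    have h1 : HasDerivAt η (-k⁻¹ * (W x * Real.sin (θ x) ^ 2)) x :=
      (funext h.eqn : η = _) ▸ hx.const_mul (-k⁻¹)
    exact (((hasDerivAt_id x).const_mul k).add h1).congr_deriv (by ring)
  set r : ℝ → ℝ := fun x => Real.exp (k⁻¹ * A x) with hr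
  have hrc : Continuous r := by fun_prop
  have hrac : AbsolutelyContinuousOnInterval r 0 1 :=
    hAac.contDiff_comp (φ := fun y => Real.exp (k⁻¹ * y)) (by fun_prop)
  have hrd : ∀ᵐ x ∂unitMeasure,
      HasDerivAt r (r x * (k⁻¹ * (W x * (Real.sin (θ x) * Real.cos (θ x))))) x := by
    filter_upwards [hAd] with x hx using (hx.const_mul k⁻¹).exp
  set u : ℝ → ℝ := fun x => k⁻¹ * (r x * Real.sin (θ x)) with hu
  set v : ℝ → ℝ := fun x => r x * Real.cos (θ x) with hv
  have hvc : Continuous v := by fun_prop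
  have huac : AbsolutelyContinuousOnInterval u 0 1 :=
    (hrac.fun_mul (hθac.contDiff_comp Real.contDiff_sin)).const_mul k⁻¹
  have hvac : AbsolutelyContinuousOnInterval v 0 1 :=
    hrac.fun_mul (hθac.contDiff_comp Real.contDiff_cos)
  have hud : ∀ᵐ x ∂unitMeasure, HasDerivAt u (v x) x := by
    filter_upwards [hrd, hθd] with x h1 h2
    refine ((h1.mul h2.sin).const_mul k⁻¹).congr_deriv ?_
    simp only [hv]
    field_simp
    ring
  have hvd : ∀ᵐ x ∂unitMeasure, HasDerivAt v ((W x - k ^ 2) * u x) x := by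
    filter_upwards [hrd, hθd] with x h1 h2
    refine (h1.mul h2.cos).congr_deriv ?_
    simp only [hu]
    have := Real.sin_sq_add_cos_sq (θ x)
    field_simp
    linear_combination (r x * Real.sin (θ x) * W x) * this
  have hη0 : η 0 = 0 := by rw [h.eqn]; simp
  have hθ0 : θ 0 = 0 := by simp [hθ, hη0]
  have hu0 : u 0 = 0 := by simp [hu, hθ0]
  have hv0 : v 0 = 1 := by simp [hv, hθ0, hr, hA]
  -- The derivative is wanted at every point, not just almost everywhere; it exists because `u` is
  -- an indefinite integral of the continuous `v`.
  have hu' : ∀ x ∈ Icc (0 : ℝ) 1, HasDerivWithinAt u (v x) (Icc 0 1) x := by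
    have hrep : ∀ x ∈ Icc (0 : ℝ) 1, u x = ∫ t in (0 : ℝ)..x, v t := by
      intro x hx
      rw [AbsolutelyContinuousOnInterval.integral_eq_sub hx.1 (huac.mono ?_)
        (ae_restrict_of_ae_restrict_of_subset (Icc_subset_Icc_right hx.2) hud), hu0, sub_zero]
      rw [uIcc_of_le hx.1, uIcc_of_le zero_le_one]
      exact Icc_subset_Icc_right hx.2
    intro x hx
    exact (hvc.integral_hasStrictDerivAt 0 x).hasDerivAt.hasDerivWithinAt.congr hrep (hrep x hx)
  refine ⟨fun x => (u x : ℂ), fun x => (v x : ℂ), fun x hx => ?_, hvac.ofReal, ?_, ?_, ?_, ?_⟩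
  · exact (hu' x hx).ofReal_comp
  · filter_upwards [hvd] with x hx
    exact hx.ofReal_comp.congr_deriv (by push_cast; rfl)
  · simp [hu0]
  · simp [hv0]
  · rw [Complex.ofReal_eq_zero]
    have hr1 : r 1 ≠ 0 := (Real.exp_pos _).ne'
    simp [hu, hθ, hk.ne', hr1]

end Phase

/-! ### Quantization condition and eigenvalue asymptotics -/

/-- A solution of the initial value problem that vanishes at `1` is an eigenfunction. -/
theorem eigenspace_ne_bot_of_solution {V : ℝ → ℝ} {z : ℂ} {u v : ℝ → ℂ}
    (h : SolvesDirichlet V u v (fun x => z * u x)) (hv0 : v 0 = 1) :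
    eigenspace (schrodingerOp V) z ≠ ⊥ := by
  obtain ⟨C, hC⟩ := isCompact_Icc.exists_bound_of_continuousOn h.continuousOn
  have hmem : MemLp u 2 unitMeasure :=
    MemLp.of_bound (h.continuousOn.aestronglyMeasurable measurableSet_Icc) C
      ((ae_restrict_mem measurableSet_Icc).mono hC)
  intro hbot
  have hf : hmem.toLp u ∈ eigenspace (schrodingerOp V) z :=
    mem_eigenspace_iff.2 ⟨u, v, hmem.coeFn_toLp, h⟩
  rw [hbot, Submodule.mem_bot, Lp.eq_zero_iff_ae_eq_zero] at hf
  have hue : EqOn u (fun _ => 0) (Icc 0 1) :=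
    Measure.eqOn_Icc_of_ae_eq volume zero_ne_one (hmem.coeFn_toLp.symm.trans hf)
      h.continuousOn continuousOn_const
  have h0 : (0 : ℝ) ∈ Icc (0 : ℝ) 1 := left_mem_Icc.2 zero_le_one
  have : v 0 = 0 := (uniqueDiffOn_Icc zero_lt_one 0 h0).eq_deriv _ (h.hasDeriv 0 h0)
    ((hasDerivWithinAt_const (0 : ℝ) (Icc (0 : ℝ) 1) (0 : ℂ)).congr hue (hue h0))
  rw [hv0] at this
  exact one_ne_zero this

/-- The quantization condition: `k²` is an eigenvalue if and only if the Prüfer phase at `1`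
is a multiple of `π`. -/
theorem eigenspace_ne_bot_iff {V : ℝ → ℝ} (hV : Integrable V unitMeasure) {k : ℝ} (hk : 0 < k)
    {η : ℝ → ℝ} (h : IsPhase ((Icc (0 : ℝ) 1).indicator V) k η) :
    eigenspace (schrodingerOp V) ((k : ℂ) ^ 2) ≠ ⊥ ↔ Real.sin (k + η 1) = 0 := by
  obtain ⟨u, v, hu, hv, heq, hu0, hv0, hu1⟩ :=
    h.exists_solution ((integrable_indicator_iff measurableSet_Icc).2 hV) hk
  have heq' : ∀ᵐ x ∂unitMeasure, HasDerivAt v (((V x : ℂ) - (k : ℂ) ^ 2) * u x) x := by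
    filter_upwards [heq, ae_restrict_mem measurableSet_Icc] with x h1 h2
    rwa [indicator_of_mem h2] at h1
  rw [← hu1]
  constructor
  · intro hne
    obtain ⟨f, hf, hf0⟩ := Submodule.exists_mem_ne_zero_of_ne_bot hne
    obtain ⟨u', v', hu', h'⟩ := mem_eigenspace_iff.1 hf
    have hp := eigensolutions_proportional hV hu hv heq' hu0 h'.hasDeriv h'.absCont h'.eqn_eigen
      h'.left 1 (right_mem_Icc.2 zero_le_one)
    rw [h'.right, mul_zero] at hp
    exact (mul_eq_zero.1 hp.symm).resolve_left (h'.deriv_zero_ne_zero hV hu' hf0)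
  · intro h1
    refine eigenspace_ne_bot_of_solution (u := u) (v := v) ⟨hu, hv, hu0, h1, ?_⟩ hv0
    filter_upwards [heq'] with x hx
    exact hx.congr_deriv (by ring)

/-- Eigenvalue asymptotics: up to finitely many exceptions, the eigenvalues are the squares of
numbers `κ n` with `κ n = π (n + N) + O(1 / (n + N))`. -/
theorem exists_eigenvalue_sequence {V : ℝ → ℝ} (hV : Integrable V unitMeasure) :
    ∃ (N : ℕ) (κ : ℕ → ℝ) (C : ℝ), 1 ≤ N ∧ (∀ n : ℕ, ((n + N : ℕ) : ℝ) ≤ κ n) ∧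
      (∀ n : ℕ, |κ n - Real.pi * (n + N : ℕ)| ≤ C / (n + N : ℕ)) ∧ Function.Injective κ ∧
      (∀ n, eigenspace (schrodingerOp V) ((κ n : ℂ) ^ 2) ≠ ⊥) ∧
      {z : ℂ | eigenspace (schrodingerOp V) z ≠ ⊥ ∧ ∀ n, (κ n : ℂ) ^ 2 ≠ z}.Finite := by
  set W := (Icc (0 : ℝ) 1).indicator V with hWdef
  have hW : Integrable W := (integrable_indicator_iff measurableSet_Icc).2 hV
  set M := ∫ t, ‖W t‖ with hM
  have hM0 : 0 ≤ M := integral_nonneg fun _ => norm_nonneg _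
  set K := 8 * (M + 1) with hK
  have hex : ∀ k, K ≤ k → ∃ η, IsPhase W k η := fun k hk => exists_phase hW (by linarith)
  choose! η hη using hex
  have hpi := Real.pi_gt_three
  have hlip : ∀ k₁ k₂, K ≤ k₁ → K ≤ k₂ → |η k₁ 1 - η k₂ 1| ≤ 1 / 2 * |k₁ - k₂| :=
    fun k₁ k₂ h₁ h₂ => IsPhase.lipschitz hW h₁ h₂ (hη _ h₁) (hη _ h₂)
  have habs : ∀ k, K ≤ k → |η k 1| ≤ M / k := fun k hk =>
    (hη k hk).abs_le hW (by linarith) 1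
  have habs1 : ∀ k, K ≤ k → |η k 1| ≤ 1 := fun k hk =>
    (habs k hk).trans ((div_le_one (by linarith)).2 (by linarith))
  have hinj : ∀ k₁ k₂, K ≤ k₁ → K ≤ k₂ → k₁ + η k₁ 1 = k₂ + η k₂ 1 → k₁ = k₂ := by
    intro k₁ k₂ h₁ h₂ he
    have h3 := hlip k₁ k₂ h₁ h₂
    rw [show η k₁ 1 - η k₂ 1 = -(k₁ - k₂) by linarith, abs_neg] at h3
    have h4 : |k₁ - k₂| ≤ 0 := by linarith [abs_nonneg (k₁ - k₂)]
    exact sub_eq_zero.1 (abs_nonpos_iff.1 h4)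
  have hcont : ContinuousOn (fun k => k + η k 1) (Ici K) := by
    refine continuousOn_id.add (LipschitzOnWith.continuousOn (K := 1 / 2) ?_)
    refine LipschitzOnWith.of_dist_le_mul fun k₁ h₁ k₂ h₂ => ?_
    simpa [Real.dist_eq] using hlip k₁ k₂ h₁ h₂
  -- As `|η k 1| ≤ 1`, the function `k + η k 1` crosses the level `y` between `k = y - 1` and `k = y
  -- + 1`.
  have hroot : ∀ y, K + 1 ≤ y → ∃ k, K ≤ k ∧ y - 1 ≤ k ∧ k + η k 1 = y := by
    intro y hy
    have h1 : y - 1 ≤ y + 1 := by linarith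
    have h2 := intermediate_value_Icc h1 (hcont.mono fun x hx => by
      have := hx.1; simp only [mem_Ici]; linarith)
    have h3 := abs_le.1 (habs1 (y - 1) (by linarith))
    have h4 := abs_le.1 (habs1 (y + 1) (by linarith))
    obtain ⟨k, hk, hk'⟩ := h2 (show y ∈ _ from ⟨by linarith, by linarith⟩)
    exact ⟨k, by linarith [hk.1], hk.1, hk'⟩
  -- This `N` puts every `π m` with `m ≥ N` in the range of `hroot`. Moreover `π m - 1 ≥ m` yields
  -- the lower bound `κ n ≥ n + N`.
  obtain ⟨N, hN⟩ := exists_nat_ge (K + 1)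
  have hN1 : (1 : ℝ) ≤ N := by linarith
  have hcast : ∀ n : ℕ, ((n + N : ℕ) : ℝ) = n + N := fun n => by push_cast; rfl
  have hge : ∀ n : ℕ, (N : ℝ) ≤ ((n + N : ℕ) : ℝ) := fun n => by
    rw [hcast]; linarith [Nat.cast_nonneg (α := ℝ) n]
  have hπ : ∀ y : ℝ, 1 ≤ y → y + 1 ≤ Real.pi * y := fun y hy => by nlinarith
  have hseq : ∀ n : ℕ, ∃ k, K ≤ k ∧ Real.pi * (n + N : ℕ) - 1 ≤ k ∧
      k + η k 1 = Real.pi * (n + N : ℕ) := fun n => hroot _ (by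
    have := hge n
    have := hπ _ (hN1.trans this)
    linarith)
  choose κ hκK hκ1 hκ2 using hseq
  have hκge : ∀ n : ℕ, ((n + N : ℕ) : ℝ) ≤ κ n := fun n => by
    have := hπ _ (hN1.trans (hge n)); linarith [hκ1 n]
  refine ⟨N, κ, M, by exact_mod_cast hN1, hκge, fun n => ?_, fun a b hab => ?_, fun n => ?_, ?_⟩
  · have h1 : κ n - Real.pi * (n + N : ℕ) = -η (κ n) 1 := by linarith [hκ2 n]
    rw [h1, abs_neg]
    have h0 : (0 : ℝ) < (n + N : ℕ) := by linarith [hge n]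
    exact (habs _ (hκK n)).trans (div_le_div_of_nonneg_left hM0 h0 (hκge n))
  · have h1 : Real.pi * (a + N : ℕ) = Real.pi * (b + N : ℕ) := by rw [← hκ2 a, ← hκ2 b, hab]
    have h2 := mul_left_cancel₀ Real.pi_ne_zero h1
    have h3 : a + N = b + N := by exact_mod_cast h2
    omega
  · rw [eigenspace_ne_bot_iff hV (by linarith [hκK n]) (hη _ (hκK n)), hκ2, mul_comm]
    exact Real.sin_nat_mul_pi _
  -- All exceptions lie below `(π N + 1)²`: if `k = √z` exceeds `π N + 1`, then `k + η k 1 = π m`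
  -- with `m > N`, and injectivity identifies `k` with `κ (m - N)`.
  · refine ((finite_eigenvalue_le hV ((Real.pi * N + 1) ^ 2)).image
      (fun a : ℝ => (a : ℂ))).subset ?_
    rintro z ⟨hz, hzκ⟩
    have hzre := eigenvalue_real hz
    refine ⟨z.re, ⟨?_, by rwa [hzre]⟩, hzre⟩
    by_contra! hlt
    set k := √z.re with hk
    have hkk : k ^ 2 = z.re := Real.sq_sqrt (by nlinarith)
    have hNN := hπ N hN1
    have hkgt : Real.pi * N + 1 < k := Real.lt_sqrt_of_sq_lt hlt
    have hkK : K ≤ k := by linarith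
    have hzk : (k : ℂ) ^ 2 = z := by rw [← hzre, ← hkk]; push_cast; rfl
    rw [← hzk, eigenspace_ne_bot_iff hV (by linarith) (hη k hkK), Real.sin_eq_zero_iff] at hz
    obtain ⟨m, hm⟩ := hz
    have h1 := abs_le.1 (habs1 k hkK)
    have h2 : (N : ℝ) < m := by
      have : Real.pi * N < Real.pi * m := by linarith [mul_comm Real.pi (m : ℝ)]
      exact lt_of_mul_lt_mul_left this Real.pi_pos.le
    have h3 : (N : ℤ) < m := by exact_mod_cast h2
    obtain ⟨n, hn⟩ := Int.eq_ofNat_of_zero_le (show 0 ≤ m - N by omega)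
    have h4 : m = ((n + N : ℕ) : ℤ) := by push_cast; omega
    have h5 : (m : ℝ) = ((n + N : ℕ) : ℝ) := by rw [h4]; push_cast; rfl
    refine hzκ n ?_
    rw [hinj (κ n) k (hκK n) hkK (by rw [hκ2, ← hm, h5, mul_comm]), hzk]

/-! ### Comparison with the powers of the free eigenvalues -/

/-- Powers of nearby positive numbers with the same exponent are close. -/
theorem norm_ofReal_cpow_sub_le {m a b : ℝ} (hm : 0 < m) (ha : m ≤ a) (hb : m ≤ b) {w : ℂ}
    (hw : -1 < w.re) :
    ‖(a : ℂ) ^ (-w) - (b : ℂ) ^ (-w)‖ ≤ ‖w‖ * m ^ (-w.re - 1) * |a - b| := by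
  have hd : ∀ x ∈ Ici m, HasDerivWithinAt (fun y : ℝ => (y : ℂ) ^ (-w))
      (-w * (x : ℂ) ^ (-w - 1)) (Ici m) x := by
    intro x hx
    have hx0 : 0 < x := hm.trans_le hx
    have h1 : HasDerivAt (fun y : ℂ => y ^ (-w)) (-w * (x : ℂ) ^ (-w - 1)) (x : ℂ) := by
      simpa using (hasDerivAt_id (x : ℂ)).cpow_const (c := -w)
        (Complex.ofReal_mem_slitPlane.2 hx0)
    exact h1.comp_ofReal.hasDerivWithinAt
  refine (convex_Ici m).norm_image_sub_le_of_norm_hasDerivWithin_le hd (fun x hx => ?_) hb ha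
  have hx0 : 0 < x := hm.trans_le hx
  rw [norm_mul, norm_neg, Complex.norm_cpow_eq_rpow_re_of_pos hx0]
  gcongr
  simp only [Complex.sub_re, Complex.neg_re, Complex.one_re]
  exact Real.rpow_le_rpow_of_nonpos hm hx (by linarith)

theorem ofReal_sq_cpow {x : ℝ} (hx : 0 < x) (s : ℂ) :
    ((x : ℂ) ^ 2) ^ (-s) = (x : ℂ) ^ (-(2 * s)) := by
  rw [sq, Complex.mul_cpow_ofReal_nonneg hx.le hx.le, ← Complex.cpow_add _ _
    (Complex.ofReal_ne_zero.2 hx.ne')]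
  congr 1; ring

section Comparison

variable {N : ℕ} {κ : ℕ → ℝ} {C : ℝ}

/-- Both bases are at least `m = n + N`, so the derivative contributes `m ^ (-2σ - 1)` and the
distance `C / m`. The resulting exponent is below `-1` exactly when `σ > -1/2`, which is where the
half-plane comes from. -/
theorem norm_power_difference_le (hN : 1 ≤ N)
    (hge : ∀ n : ℕ, ((n + N : ℕ) : ℝ) ≤ κ n)
    (hκ : ∀ n : ℕ, |κ n - Real.pi * (n + N : ℕ)| ≤ C / (n + N : ℕ)) {s : ℂ} {σ R : ℝ}
    (hσ : -(1 / 2) < σ) (hs : σ ≤ s.re) (hR : ‖s‖ ≤ R) (n : ℕ) :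
    ‖(κ n : ℂ) ^ (-(2 * s)) - ((Real.pi * (n + N : ℕ) : ℝ) : ℂ) ^ (-(2 * s))‖ ≤
      2 * R * C * ((n + N : ℕ) : ℝ) ^ (-2 * σ - 2) := by
  set m : ℝ := ((n + N : ℕ) : ℝ) with hm
  have hm1 : 1 ≤ m := by rw [hm]; exact_mod_cast (by omega : 1 ≤ n + N)
  have hm0 : 0 < m := by linarith
  have hb : m ≤ Real.pi * m := le_mul_of_one_le_left hm0.le (by linarith [Real.pi_gt_three])
  have hre : (2 * s).re = 2 * s.re := by simp
  have h := norm_ofReal_cpow_sub_le hm0 (hge n) hb (w := 2 * s) (by rw [hre]; linarith)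
  have hn : ‖2 * s‖ = 2 * ‖s‖ := by simp
  rw [hre, hn] at h
  have hR0 : 0 ≤ R := (norm_nonneg s).trans hR
  calc _ ≤ _ := h
    _ ≤ 2 * R * m ^ (-(2 * σ) - 1) * (C / m) := by
        gcongr
        exact hκ n
    _ = 2 * R * C * (m ^ (-(2 * σ) - 1) * m ^ (-1 : ℝ)) := by
        rw [Real.rpow_neg_one]; ring
    _ = _ := by rw [← Real.rpow_add hm0]; ring_nf

theorem summable_shift_rpow (N : ℕ) {p : ℝ} (hp : p < -1) :
    Summable fun n : ℕ => ((n + N : ℕ) : ℝ) ^ p :=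
  (summable_nat_add_iff N).2 (Real.summable_nat_rpow.2 hp)

/-- Weierstrass' test, applied near each point: the majorant needs a lower bound on `Re s` and an
upper bound on `‖s‖`, hence a half-plane cut by a ball. -/
theorem differentiableOn_tsum_power_difference (hN : 1 ≤ N)
    (hge : ∀ n : ℕ, ((n + N : ℕ) : ℝ) ≤ κ n)
    (hκ : ∀ n : ℕ, |κ n - Real.pi * (n + N : ℕ)| ≤ C / (n + N : ℕ)) :
    DifferentiableOn ℂ (fun s : ℂ => ∑' n : ℕ, ((κ n : ℂ) ^ (-(2 * s)) -
      ((Real.pi * (n + N : ℕ) : ℝ) : ℂ) ^ (-(2 * s)))) {s : ℂ | -(1 / 2) < s.re} := by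
  intro s₀ hs₀
  have hs₀' : -(1 / 2) < s₀.re := hs₀
  obtain ⟨σ, hσ1, hσ2⟩ := exists_between hs₀'
  have hopen : IsOpen ({s : ℂ | σ < s.re} ∩ Metric.ball 0 (‖s₀‖ + 1)) :=
    (isOpen_lt continuous_const Complex.continuous_re).inter Metric.isOpen_ball
  have hmem : s₀ ∈ {s : ℂ | σ < s.re} ∩ Metric.ball 0 (‖s₀‖ + 1) := ⟨hσ2, by simp⟩
  have hpos : ∀ n : ℕ, (0 : ℝ) < (n + N : ℕ) := fun n => by
    exact_mod_cast (by omega : 0 < n + N)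
  refine ((Complex.differentiableOn_tsum_of_summable_norm
    ((summable_shift_rpow N (p := -2 * σ - 2) (by linarith)).mul_left (2 * (‖s₀‖ + 1) * C))
    (fun n => ?_) hopen (fun n s hs => ?_)).differentiableAt
      (hopen.mem_nhds hmem)).differentiableWithinAt
  · have h1 : (κ n : ℂ) ≠ 0 := Complex.ofReal_ne_zero.2 ((hpos n).trans_le (hge n)).ne'
    have h2 : ((Real.pi * (n + N : ℕ) : ℝ) : ℂ) ≠ 0 :=
      Complex.ofReal_ne_zero.2 (mul_pos Real.pi_pos (hpos n)).ne'
    refine Differentiable.differentiableOn ?_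
    exact (Differentiable.const_cpow (by fun_prop) (Or.inl h1)).sub
      (Differentiable.const_cpow (by fun_prop) (Or.inl h2))
  · have hs2 : ‖s‖ < ‖s₀‖ + 1 := by simpa using hs.2
    exact norm_power_difference_le hN hge hκ hσ1 (le_of_lt hs.1) hs2.le n

end Comparison

/-! ### The free zeta function and simple poles -/

/-- The spectral zeta function of the free Dirichlet Laplacian. -/
noncomputable def freeZeta (s : ℂ) : ℂ := (Real.pi : ℂ) ^ (-(2 * s)) * riemannZeta (2 * s)

theorem hasSum_freeZeta {s : ℂ} (hs : 1 / 2 < s.re) :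
    HasSum (fun n : ℕ => ((Real.pi * n : ℝ) : ℂ) ^ (-(2 * s))) (freeZeta s) := by
  have h2 : 1 < (2 * s).re := by
    have : (2 * s).re = 2 * s.re := by simp
    linarith
  have h := ((Complex.summable_one_div_nat_cpow.2 h2).hasSum).mul_left
    ((Real.pi : ℂ) ^ (-(2 * s)))
  rw [← zeta_eq_tsum_one_div_nat_cpow h2] at h
  refine h.congr_fun fun n => ?_
  rw [Complex.ofReal_mul, Complex.mul_cpow_ofReal_nonneg Real.pi_pos.le (Nat.cast_nonneg n),
    Complex.ofReal_natCast, one_div, ← Complex.cpow_neg]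

theorem differentiableAt_freeZeta {s : ℂ} (hs : s ≠ 1 / 2) : DifferentiableAt ℂ freeZeta s := by
  have h2 : 2 * s ≠ 1 := fun h => hs (by rw [← h]; ring)
  have hpi : (Real.pi : ℂ) ≠ 0 := Complex.ofReal_ne_zero.2 Real.pi_ne_zero
  refine DifferentiableAt.mul (DifferentiableAt.const_cpow (by fun_prop) (Or.inl hpi)) ?_
  exact DifferentiableAt.comp s (differentiableAt_riemannZeta h2) (by fun_prop)

/-- `(s - 1/2) ζ(2s)` is half of `(2s - 1) ζ(2s)`, which tends to `1`, and `π ^ (-2s)` tends to `1 /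
π`. -/
theorem tendsto_freeZeta_residue :
    Tendsto (fun s => (s - 1 / 2) * freeZeta s) (𝓝[≠] (1 / 2)) (𝓝 (1 / (2 * (Real.pi : ℂ)))) := by
  have hpi : (Real.pi : ℂ) ≠ 0 := Complex.ofReal_ne_zero.2 Real.pi_ne_zero
  have h1 : Tendsto (fun s : ℂ => 2 * s) (𝓝[≠] (1 / 2)) (𝓝[≠] 1) := by
    refine tendsto_nhdsWithin_iff.2 ⟨?_, ?_⟩
    · have : Tendsto (fun s : ℂ => 2 * s) (𝓝 (1 / 2)) (𝓝 (2 * (1 / 2))) :=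
        (continuous_const.mul continuous_id).tendsto _
      rw [show (2 : ℂ) * (1 / 2) = 1 by norm_num] at this
      exact this.mono_left nhdsWithin_le_nhds
    · filter_upwards [self_mem_nhdsWithin] with s hs h
      exact hs (by rw [mem_singleton_iff]; rw [mem_singleton_iff] at h; rw [← h]; ring)
  have h2 := riemannZeta_residue_one.comp h1
  have h3 : Tendsto (fun s : ℂ => (Real.pi : ℂ) ^ (-(2 * s)) / 2) (𝓝[≠] (1 / 2))
      (𝓝 ((Real.pi : ℂ) ^ (-(2 * (1 / 2 : ℂ))) / 2)) := by
    have : Continuous fun s : ℂ => (Real.pi : ℂ) ^ (-(2 * s)) / 2 :=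
      (Differentiable.const_cpow (by fun_prop) (Or.inl hpi)).continuous.div_const 2
    exact (this.tendsto _).mono_left nhdsWithin_le_nhds
  have h4 := h3.mul h2
  have e : (Real.pi : ℂ) ^ (-(2 * (1 / 2 : ℂ))) / 2 * 1 = 1 / (2 * (Real.pi : ℂ)) := by
    rw [show -(2 * (1 / 2 : ℂ)) = -1 by norm_num, Complex.cpow_neg_one]
    field_simp
  rw [e] at h4
  refine h4.congr fun s => ?_
  simp only [freeZeta, Function.comp_apply]
  ring

/-- A function that is differentiable off a point, with a finite nonzero residue there, has a
simple pole. -/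
theorem hasSimplePole_of_tendsto {F : ℂ → ℂ} {z₀ r : ℂ} (hr : r ≠ 0)
    (hd : ∀ᶠ z in 𝓝[≠] z₀, DifferentiableAt ℂ F z)
    (ht : Tendsto (fun s => (s - z₀) * F s) (𝓝[≠] z₀) (𝓝 r)) :
    MeromorphicAt F z₀ ∧ HasSimplePole F z₀ r := by
  -- Removable singularity: with the value `r` at `z₀`, the product is continuous there, hence
  -- analytic, and `r ≠ 0` makes the order of `F` exactly `-1`.
  set g : ℂ → ℂ := Function.update (fun s => (s - z₀) * F s) z₀ r with hg
  have hgne : ∀ z, z ≠ z₀ → g z = (z - z₀) * F z := fun z hz => Function.update_of_ne hz _ _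
  have hgan : AnalyticAt ℂ g z₀ := by
    refine Complex.analyticAt_of_differentiable_on_punctured_nhds_of_continuousAt ?_ ?_
    · filter_upwards [hd, self_mem_nhdsWithin] with z hz hne
      have h1 : DifferentiableAt ℂ (fun s => (s - z₀) * F s) z := by fun_prop
      refine h1.congr_of_eventuallyEq ?_
      filter_upwards [isOpen_ne.mem_nhds hne] with w hw using hgne w hw
    · exact continuousAt_update_same.2 ht
  have hgF : ∀ᶠ z in 𝓝[≠] z₀, F z = (z - z₀) ^ (-1 : ℤ) • g z := by
    filter_upwards [self_mem_nhdsWithin] with z hz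
    have : z - z₀ ≠ 0 := sub_ne_zero.2 hz
    rw [hgne z hz, zpow_neg_one, smul_eq_mul]
    field_simp
  have hmer : MeromorphicAt F z₀ := by
    refine MeromorphicAt.congr (f := fun z => (z - z₀) ^ (-1 : ℤ) • g z) ?_ (by
      filter_upwards [hgF] with z hz using hz.symm)
    exact (MeromorphicAt.fun_zpow (by fun_prop) _).fun_smul hgan.meromorphicAt
  refine ⟨hmer, ?_, ht⟩
  exact (meromorphicOrderAt_eq_int_iff hmer).2 ⟨g, hgan, by simp [hg, hr], hgF⟩

/-! ### Analytic continuation of the spectral zeta function -/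

theorem hasSum_of_injective_of_fintype_compl {α β : Type*} {f : β → ℂ} {i : α → β}
    (hi : Function.Injective i) [Fintype ((range i)ᶜ : Set β)] {a : ℂ} (h : HasSum (f ∘ i) a) :
    HasSum f (a + ∑ z : ((range i)ᶜ : Set β), f z) :=
  HasSum.add_compl (hi.hasSum_range_iff.2 h)
    (hasSum_fintype fun z : ((range i)ᶜ : Set β) => f z)

section Continuation

variable {N : ℕ} {κ : ℕ → ℝ} {C : ℝ}

theorem hasSum_power_sequence (hN : 1 ≤ N)
    (hge : ∀ n : ℕ, ((n + N : ℕ) : ℝ) ≤ κ n)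
    (hκ : ∀ n : ℕ, |κ n - Real.pi * (n + N : ℕ)| ≤ C / (n + N : ℕ)) {s : ℂ}
    (hs : 1 / 2 < s.re) :
    HasSum (fun n : ℕ => (κ n : ℂ) ^ (-(2 * s)))
      (∑' n : ℕ, ((κ n : ℂ) ^ (-(2 * s)) - ((Real.pi * (n + N : ℕ) : ℝ) : ℂ) ^ (-(2 * s))) +
        (freeZeta s - ∑ m ∈ (Finset.range N).erase 0, ((Real.pi * m : ℝ) : ℂ) ^ (-(2 * s)))) := by
  have h1 : Summable fun n : ℕ => (κ n : ℂ) ^ (-(2 * s)) -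
      ((Real.pi * (n + N : ℕ) : ℝ) : ℂ) ^ (-(2 * s)) :=
    Summable.of_norm_bounded ((summable_shift_rpow N (p := -2 * s.re - 2) (by linarith)).mul_left
      (2 * ‖s‖ * C)) fun n => norm_power_difference_le hN hge hκ (by linarith) le_rfl le_rfl n
  have hs0 : s ≠ 0 := by rintro rfl; norm_num at hs
  have h2 := (hasSum_nat_add_iff' N).2 (hasSum_freeZeta hs)
  -- The term `0 ^ (-2s)` vanishes here, but at `s = 0` it would be `1`. Erasing it keeps the finite
  -- correction entire.
  rw [← Finset.sum_erase (a := 0) (Finset.range N) (by simp [hs0])] at h2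
  refine (h1.hasSum.add h2).congr_fun fun n => ?_
  ring

/-- The analytic continuation of the zeta function of an operator whose eigenvalues are, up to
finitely many exceptions, the simple eigenvalues `κ n ^ 2` with `κ n` asymptotic to `π (n + N)`. -/
theorem zeta_continuation {H : Type*} [AddCommGroup H] [Module ℂ H] (T : H →ₗ.[ℂ] H)
    (hN : 1 ≤ N) (hge : ∀ n : ℕ, ((n + N : ℕ) : ℝ) ≤ κ n)
    (hκ : ∀ n : ℕ, |κ n - Real.pi * (n + N : ℕ)| ≤ C / (n + N : ℕ))
    (hinj : Function.Injective κ) (hne : ∀ n, eigenspace T ((κ n : ℂ) ^ 2) ≠ ⊥)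
    (hrank : ∀ n, Module.finrank ℂ (eigenspace T ((κ n : ℂ) ^ 2)) = 1)
    (hfin : {z : ℂ | eigenspace T z ≠ ⊥ ∧ ∀ n, (κ n : ℂ) ^ 2 ≠ z}.Finite) :
    ∃ G : ℂ → ℂ, DifferentiableOn ℂ G {s : ℂ | -(1 / 2) < s.re} ∧
      ∀ s : ℂ, 1 / 2 < s.re → HasSum (zetaTerm T s) (G s + freeZeta s) := by
  have hκ0 : ∀ n, 0 < κ n := fun n =>
    lt_of_lt_of_le (by exact_mod_cast (by omega : 0 < n + N)) (hge n)
  let i : ℕ → nonzeroEigenvalues T := fun n =>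
    ⟨(κ n : ℂ) ^ 2, hne n, pow_ne_zero 2 (Complex.ofReal_ne_zero.2 (hκ0 n).ne')⟩
  have hi : Function.Injective i := by
    intro a b hab
    have h1 : (κ a : ℂ) ^ 2 = (κ b : ℂ) ^ 2 := congrArg Subtype.val hab
    have h2 : κ a ^ 2 = κ b ^ 2 := by exact_mod_cast h1
    exact hinj ((sq_eq_sq₀ (hκ0 a).le (hκ0 b).le).1 h2)
  have hfin' : ((range i)ᶜ : Set (nonzeroEigenvalues T)).Finite := by
    refine Set.Finite.of_finite_image (f := Subtype.val) (hfin.subset ?_)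
      Subtype.val_injective.injOn
    rintro _ ⟨z, hz, rfl⟩
    exact ⟨z.2.1, fun n hn => hz ⟨n, Subtype.ext hn⟩⟩
  have : Fintype ((range i)ᶜ : Set (nonzeroEigenvalues T)) := hfin'.fintype
  -- The witness collects the exceptional eigenvalues and the comparison series, and removes the
  -- free terms `1 ≤ m < N` that have no partner `κ n`.
  refine ⟨fun s => ∑ z : ((range i)ᶜ : Set (nonzeroEigenvalues T)), zetaTerm T s z +
    ∑' n : ℕ, ((κ n : ℂ) ^ (-(2 * s)) - ((Real.pi * (n + N : ℕ) : ℝ) : ℂ) ^ (-(2 * s))) -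
    ∑ m ∈ (Finset.range N).erase 0, ((Real.pi * m : ℝ) : ℂ) ^ (-(2 * s)), ?_, fun s hs => ?_⟩
  · refine (DifferentiableOn.add ?_
      (differentiableOn_tsum_power_difference hN hge hκ)).sub ?_
    · refine DifferentiableOn.fun_sum fun z _ => Differentiable.differentiableOn ?_
      exact (Differentiable.const_cpow (by fun_prop) (Or.inl z.1.2.2)).const_mul _
    · refine DifferentiableOn.fun_sum fun m hm => Differentiable.differentiableOn ?_
      have hm0 : m ≠ 0 := Finset.ne_of_mem_erase hm
      have h1 : ((Real.pi * m : ℝ) : ℂ) ≠ 0 := Complex.ofReal_ne_zero.2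
        (mul_ne_zero Real.pi_ne_zero (Nat.cast_ne_zero.2 hm0))
      exact Differentiable.const_cpow (by fun_prop) (Or.inl h1)
  · have e : (zetaTerm T s ∘ i) = fun n => (κ n : ℂ) ^ (-(2 * s)) := funext fun n => by
      simp only [Function.comp_apply, zetaTerm, i]
      rw [hrank, Nat.cast_one, one_mul, ofReal_sq_cpow (hκ0 n)]
    have h1 := hasSum_power_sequence hN hge hκ hs
    rw [← e] at h1
    have h2 := hasSum_of_injective_of_fintype_compl hi h1
    convert h2 using 1
    ring

end Continuation

/-- A function that differs from the free zeta function by a holomorphic function has the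
analytic properties of the free zeta function. -/
theorem meromorphic_add_freeZeta {G : ℂ → ℂ}
    (hG : DifferentiableOn ℂ G {s : ℂ | -(1 / 2) < s.re}) :
    MeromorphicOn (fun s => G s + freeZeta s) {s : ℂ | -(1 / 2) < s.re} ∧
      AnalyticOnNhd ℂ (fun s => G s + freeZeta s) ({s : ℂ | -(1 / 2) < s.re} \ {1 / 2}) ∧
      HasSimplePole (fun s => G s + freeZeta s) (1 / 2) (1 / (2 * (Real.pi : ℂ))) := by
  have hU : IsOpen {s : ℂ | -(1 / 2) < s.re} := isOpen_lt continuous_const Complex.continuous_re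
  have hhalf : (1 / 2 : ℂ) ∈ {s : ℂ | -(1 / 2) < s.re} := by norm_num
  have hdiff : DifferentiableOn ℂ (fun s => G s + freeZeta s)
      ({s : ℂ | -(1 / 2) < s.re} \ {1 / 2}) := fun s hs =>
    ((hG s hs.1).mono sdiff_subset).add (differentiableAt_freeZeta hs.2).differentiableWithinAt
  have hopen : IsOpen ({s : ℂ | -(1 / 2) < s.re} \ {1 / 2}) := hU.sdiff isClosed_singleton
  have hana := hdiff.analyticOnNhd hopen
  have hres : Tendsto (fun s => (s - 1 / 2) * (G s + freeZeta s)) (𝓝[≠] (1 / 2))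
      (𝓝 (1 / (2 * (Real.pi : ℂ)))) := by
    have h1 : Tendsto (fun s => (s - 1 / 2) * G s) (𝓝[≠] (1 / 2))
        (𝓝 ((1 / 2 - 1 / 2) * G (1 / 2))) := by
      have hc : ContinuousAt (fun s => (s - 1 / 2) * G s) (1 / 2) :=
        (continuousAt_id.sub continuousAt_const).mul
          (hG.differentiableAt (hU.mem_nhds hhalf)).continuousAt
      exact hc.tendsto.mono_left nhdsWithin_le_nhds
    have h2 := h1.add tendsto_freeZeta_residue
    rw [sub_self, zero_mul, zero_add] at h2
    exact h2.congr fun s => by ring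
  have hne : (1 / (2 * (Real.pi : ℂ))) ≠ 0 := by simp [Real.pi_ne_zero]
  have hpole := hasSimplePole_of_tendsto hne (by
    filter_upwards [self_mem_nhdsWithin, nhdsWithin_le_nhds (hU.mem_nhds hhalf)] with z hz hz'
    exact (hana z ⟨hz', hz⟩).differentiableAt) hres
  refine ⟨fun s hs => ?_, hana, hpole.2⟩
  by_cases h : s = 1 / 2
  · rw [h]; exact hpole.1
  · exact (hana s ⟨hs, h⟩).meromorphicAt

end DirichletSchrodinger

theorem mainTheorem5 (q : ℝ≥0∞) (hq : 1 ≤ q) (V : ℝ → ℝ)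
    (hV : MemLp V q DirichletSchrodinger.unitMeasure) :
    -- every eigenvalue has finite multiplicity
    (∀ z : ℂ, FiniteDimensional ℂ
      (DirichletSchrodinger.eigenspace (DirichletSchrodinger.schrodingerOp V) z)) ∧
    -- the zeta series converges absolutely for `Re s > 1/2`
    (∀ s : ℂ, 1 / 2 < s.re →
      Summable (DirichletSchrodinger.zetaTerm (DirichletSchrodinger.schrodingerOp V) s)) ∧
    -- and has a meromorphic extension to `Re s > -1/2` with a single, simple pole
    ∃ F : ℂ → ℂ,
      MeromorphicOn F {s : ℂ | -(1 / 2) < s.re} ∧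
      (∀ s : ℂ, 1 / 2 < s.re →
        F s = DirichletSchrodinger.spectralZeta (DirichletSchrodinger.schrodingerOp V) s) ∧
      AnalyticOnNhd ℂ F ({s : ℂ | -(1 / 2) < s.re} \ {1 / 2}) ∧
      DirichletSchrodinger.HasSimplePole F (1 / 2) (1 / (2 * (Real.pi : ℂ))) ∧
      AnalyticAt ℂ F 0 := by
  have hVi : Integrable V DirichletSchrodinger.unitMeasure := hV.integrable hq
  obtain ⟨N, κ, C, hN, hge, hκ, hinj, hne, hfin⟩ :=
    DirichletSchrodinger.exists_eigenvalue_sequence hVi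
  obtain ⟨G, hG, hsum⟩ := DirichletSchrodinger.zeta_continuation _ hN hge hκ hinj hne
    (fun n => DirichletSchrodinger.finrank_eigenspace hVi (hne n)) hfin
  obtain ⟨hmer, hana, hpole⟩ := DirichletSchrodinger.meromorphic_add_freeZeta hG
  refine ⟨DirichletSchrodinger.finiteDimensional_eigenspace hVi, fun s hs => (hsum s hs).summable,
    _, hmer, fun s hs => (hsum s hs).tsum_eq.symm, hana, hpole, hana 0 ⟨?_, ?_⟩⟩
  · norm_num
  · norm_num
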